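/- Let $a>0$, $\Omega=(-a,a)\times(-1,1)$, and let $\alpha_i,\beta_i\ge 0$ with $\alpha_i+\beta_i=1$ ($i=1,2$). Let $K_1:L^1((-1,0);dv)\to L^1((0,1);dv)$ and $K_2:L^1((0,1);dv)\to L^1((-1,0);dv)$ be weakly compact bounded operators that are stochastic (positive, and norm preserving on the positive cone). Put $O_i=\alpha_iR_i+\beta_iK_i$, where $(R_i\varphi)(v)=\varphi(-v)$ is specular reflection between the same spaces. Let $T_O$ be the operator in $L^1(\Omega)$ given by $T_Of=-v\,\partial f/\partial x$ (in the sense of distributions), whose domain consists of all $f\in L^1(\Omega)$ with $v\,\partial f/\partial x\in L^1(\Omega)$ and $h_{-a}^{+}=O_1h_{-a}^{-}$, $h_{a}^{-}=O_2h_{a}^{+}$, where $h_{\pm a}^{+}$ and $h_{\pm a}^{-}$ are the restrictions to $v\in(0,1)$ and to $v\in(-1,0)$ of $|v|f(\pm a,v)$, with $f(\pm a,\cdot)$ the traces of $f$ at $x=\pm a$. The $C_0$-semigroup $(e^{tT_O})_{t\ge0}$ is the one with generator $T_O$. Assume that * either $O_1=K_1$ and both $|v|^{-1}K_1$ and $|v|^{-1}K_2|v|$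 are bounded operators on the $L^1(dv)$ spaces, * or $O_2=K_2$ and both $|v|^{-1}K_2$ and $|v|^{-1}K_1|v|$ are bounded, where $|v|^{j}$ denotes the operator of multiplication by the function $|v|^j$. Then there are nontrivial nonnegative $h_0\in L^1((0,1);dv)$ and $\widetilde h_0\in L^1((-1,0);dv)$ with $O_2h_0=\widetilde h_0$ and $O_1\widetilde h_0=h_0$ (so $O_1O_2h_0=h_0$ and $O_2O_1\widetilde h_0=\widetilde h_0$), and every such pair satisfies $$\int_0^1\frac{h_0(v)}{v}\,dv+\int_{-1}^0\frac{\widetilde h_0(v)}{|v|}\,dv<\infty .$$ Moreover $T_O$ generates a $C_0$-semigroup $(e^{tT_O})_{t\ge0}$ on $L^1(\Omega)$, and this semigroup has an invariant density: there is $\psi\in L^1(\Omega)$ with $\psi\ge0$, $\int_\Omega\psi=1$ and $e^{tT_O}\psi=\psi$ for all $t\ge0$. -/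

import Mathlib

open MeasureTheory Set Filter Topology
open scoped NNReal ENNReal

noncomputable section

namespace SlabTransport

/-- The half-interval `(-1, 0)` of velocities. -/
abbrev Ineg : Set ℝ := Ioo (-1) 0

/-- The half-interval `(0, 1)` of velocities. -/
abbrev Ipos : Set ℝ := Ioo 0 1

/-- The space `L¹(I; dv)`. -/
abbrev L1 (I : Set ℝ) : Type := Lp ℝ 1 ((volume : Measure ℝ).restrict I)

/-- Lebesgue measure on the phase space `Ω = (-a, a) × (-1, 1)`, with points `(x, v)`. -/
abbrev phaseMeasure (a : ℝ) : Measure (ℝ × ℝ) :=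
  ((volume : Measure ℝ).restrict (Ioo (-a) a)).prod ((volume : Measure ℝ).restrict (Ioo (-1) 1))

/-- The space `L¹(Ω)`, `Ω = (-a, a) × (-1, 1)`. -/
abbrev L1Phase (a : ℝ) : Type := Lp ℝ 1 (phaseMeasure a)

/-! ### Boundary operators -/

/-- A stochastic operator: positive, and norm preserving on the positive cone. -/
def IsStochastic {I J : Set ℝ} (K : L1 I →L[ℝ] L1 J) : Prop :=
  ∀ f : L1 I, 0 ≤ f → 0 ≤ K f ∧ ‖K f‖ = ‖f‖

/-- A weakly compact operator: the image of the unit ball is relatively compact in the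
weak topology. -/
def IsWeaklyCompact {E F : Type*} [NormedAddCommGroup E] [NormedSpace ℝ E]
    [NormedAddCommGroup F] [NormedSpace ℝ F] (K : E →L[ℝ] F) : Prop :=
  IsCompact (closure (toWeakSpace ℝ F '' (K '' Metric.closedBall 0 1)))

theorem measurePreserving_neg_pos_neg : MeasurePreserving (fun v : ℝ => -v)
    ((volume : Measure ℝ).restrict Ipos) ((volume : Measure ℝ).restrict Ineg) := by
  have h := (Measure.measurePreserving_neg (volume : Measure ℝ)).restrict_preimage
    (s := Ineg) measurableSet_Ioo
  have e : (Neg.neg : ℝ → ℝ) ⁻¹' Ineg = Ipos := by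
    ext v; simp
  rw [e] at h
  exact h

theorem measurePreserving_neg_neg_pos : MeasurePreserving (fun v : ℝ => -v)
    ((volume : Measure ℝ).restrict Ineg) ((volume : Measure ℝ).restrict Ipos) := by
  have h := (Measure.measurePreserving_neg (volume : Measure ℝ)).restrict_preimage
    (s := Ipos) measurableSet_Ioo
  have e : (Neg.neg : ℝ → ℝ) ⁻¹' Ipos = Ineg := by
    ext v; simp [and_comm, neg_lt]
  rw [e] at h
  exact h

/-- Specular reflection `R₁ : L¹(-1,0) → L¹(0,1)`, `(R₁ φ)(v) = φ(-v)`. -/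
def R₁ : L1 Ineg →L[ℝ] L1 Ipos :=
  (Lp.compMeasurePreservingₗᵢ ℝ (fun v : ℝ => -v)
    measurePreserving_neg_pos_neg).toContinuousLinearMap

/-- Specular reflection `R₂ : L¹(0,1) → L¹(-1,0)`, `(R₂ φ)(v) = φ(-v)`. -/
def R₂ : L1 Ipos →L[ℝ] L1 Ineg :=
  (Lp.compMeasurePreservingₗᵢ ℝ (fun v : ℝ => -v)
    measurePreserving_neg_neg_pos).toContinuousLinearMap

/-- `O₁ = α₁ R₁ + β₁ K₁`. -/
def O₁ (α₁ β₁ : ℝ) (K₁ : L1 Ineg →L[ℝ] L1 Ipos) : L1 Ineg →L[ℝ] L1 Ipos :=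
  α₁ • R₁ + β₁ • K₁

/-- `O₂ = α₂ R₂ + β₂ K₂`. -/
def O₂ (α₂ β₂ : ℝ) (K₂ : L1 Ipos →L[ℝ] L1 Ineg) : L1 Ipos →L[ℝ] L1 Ineg :=
  α₂ • R₂ + β₂ • K₂

/-- `|v|⁻¹ K` is (i.e. extends to, as an operator on all of `L¹`) a bounded operator
`L¹(I; dv) → L¹(J; dv)`. -/
def InvWeightBounded {I J : Set ℝ} (K : L1 I →L[ℝ] L1 J) : Prop :=
  ∃ B : L1 I →L[ℝ] L1 J, ∀ f : L1 I,
    ∀ᵐ v ∂((volume : Measure ℝ).restrict J), B f v = |v|⁻¹ * K f v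

/-- `|v|⁻¹ K |v|` is a bounded operator `L¹(I; dv) → L¹(J; dv)`; here `g = |v| f`. -/
def ConjWeightBounded {I J : Set ℝ} (K : L1 I →L[ℝ] L1 J) : Prop :=
  ∃ B : L1 I →L[ℝ] L1 J, ∀ f g : L1 I,
    (∀ᵐ v ∂((volume : Measure ℝ).restrict I), g v = |v| * f v) →
    ∀ᵐ v ∂((volume : Measure ℝ).restrict J), B f v = |v|⁻¹ * K g v

/-- A nontrivial nonnegative pair `(h, h')` with `P₂ h = h'` and `P₁ h' = h`; thus
`P₁ P₂ h = h` and `P₂ P₁ h' = h'`, i.e. `h` and `h'` are nonnegative eigenfunctions of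
`G₀ = P₁ P₂` and of `P₂ P₁` for the eigenvalue `1`. -/
structure IsEigenPair (P₁ : L1 Ineg →L[ℝ] L1 Ipos) (P₂ : L1 Ipos →L[ℝ] L1 Ineg)
    (h : L1 Ipos) (h' : L1 Ineg) : Prop where
  nonneg : 0 ≤ h
  nonneg' : 0 ≤ h'
  ne_zero : h ≠ 0
  map_h : P₂ h = h'
  map_h' : P₁ h' = h

/-- The integrability condition `∫₀¹ h(v)/v dv + ∫₋₁⁰ h'(v)/|v| dv < ∞`. -/
def IntegrabilityCondition (h : L1 Ipos) (h' : L1 Ineg) : Prop :=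
  (∫⁻ v in Ipos, ENNReal.ofReal (h v / v)) + (∫⁻ v in Ineg, ENNReal.ofReal (h' v / |v|)) < ∞

/-! ### The transport operator -/

/-- `w = v ∂f/∂x` in the sense of distributions on `Ω = (-a, a) × (-1, 1)`. -/
def HasWeakStreaming (a : ℝ) (f w : L1Phase a) : Prop :=
  ∀ φ : ℝ × ℝ → ℝ, ContDiff ℝ (⊤ : ℕ∞) φ → HasCompactSupport φ →
    tsupport φ ⊆ Ioo (-a) a ×ˢ Ioo (-1) 1 →
    ∫ p, f p * (p.2 * fderiv ℝ φ p (1, 0)) ∂(phaseMeasure a) =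
      - ∫ p, w p * φ p ∂(phaseMeasure a)

/-- `u` is the trace on `{c} × (-1, 1)`, `c = -a` or `c = a`, of a function `f` with
`v ∂f/∂x = w`: it is the value at `x = c` of the absolutely continuous representative
`x ↦ u(v) + v⁻¹ ∫_c^x w(y, v) dy` of `f(·, v)`, for almost every `v`. -/
def IsTrace (a c : ℝ) (f w : L1Phase a) (u : ℝ → ℝ) : Prop :=
  ∀ᵐ p ∂(phaseMeasure a), p.2 * f p = p.2 * u p.2 + ∫ y in c..p.1, w (y, p.2)

/-- `h = |v| u` on `I`, as elements of `L¹(I; dv)`. -/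
def IsFlux (I : Set ℝ) (u : ℝ → ℝ) (h : L1 I) : Prop :=
  ∀ᵐ v ∂((volume : Measure ℝ).restrict I), h v = |v| * u v

/-- The graph of the transport operator `T f = - v ∂f/∂x` with domain
`{f ∈ L¹(Ω) : v ∂f/∂x ∈ L¹(Ω), h₋ₐ⁺ = P₁ h₋ₐ⁻, hₐ⁻ = P₂ hₐ⁺}`: the pair `(f, g)` belongs to it
iff `f` is in the domain and `T f = g`. Here `u` and `u'` are the traces of `f` at `x = -a` and
`x = a`, and `hl⁻ = |v| u` on `(-1, 0)`, `hl⁺ = |v| u` on `(0, 1)`, `hr⁻ = |v| u'` on `(-1, 0)`,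
`hr⁺ = |v| u'` on `(0, 1)`. -/
def transportGraph (a : ℝ) (P₁ : L1 Ineg →L[ℝ] L1 Ipos) (P₂ : L1 Ipos →L[ℝ] L1 Ineg) :
    Set (L1Phase a × L1Phase a) :=
  {q | HasWeakStreaming a q.1 (-q.2) ∧
    ∃ (u u' : ℝ → ℝ) (hlneg hrneg : L1 Ineg) (hlpos hrpos : L1 Ipos),
      IsTrace a (-a) q.1 (-q.2) u ∧ IsTrace a a q.1 (-q.2) u' ∧
      IsFlux Ineg u hlneg ∧ IsFlux Ipos u hlpos ∧
      IsFlux Ineg u' hrneg ∧ IsFlux Ipos u' hrpos ∧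
      hlpos = P₁ hlneg ∧ hrneg = P₂ hrpos}

/-! ### Semigroups -/

/-- A strongly continuous one-parameter semigroup of bounded operators. -/
structure C0Semigroup (E : Type*) [NormedAddCommGroup E] [NormedSpace ℝ E] where
  /-- The operator at time `t`. -/
  op : ℝ≥0 → E →L[ℝ] E
  op_zero : op 0 = ContinuousLinearMap.id ℝ E
  op_add : ∀ s t, op (s + t) = (op s).comp (op t)
  continuous_orbit : ∀ f, Continuous fun t => op t f

/-- The graph of the infinitesimal generator of a semigroup. -/
def C0Semigroup.generatorGraph {E : Type*} [NormedAddCommGroup E] [NormedSpace ℝ E]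
    (S : C0Semigroup E) : Set (E × E) :=
  {q | Tendsto (fun t : ℝ≥0 => (t : ℝ)⁻¹ • (S.op t q.1 - q.1)) (𝓝[>] 0) (𝓝 q.2)}

/-- An invariant density: `ψ ≥ 0`, `∫_Ω ψ = 1`, and `S(t) ψ = ψ` for all `t ≥ 0`. -/
def IsInvariantDensity {a : ℝ} (S : C0Semigroup (L1Phase a)) (ψ : L1Phase a) : Prop :=
  0 ≤ ψ ∧ ∫ p, ψ p ∂(phaseMeasure a) = 1 ∧ ∀ t, S.op t ψ = ψ

end SlabTransport

end

open SlabTransport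

open SlabTransport

/-! Along a line of constant velocity `v`, the equation `l f + v ∂f/∂x = h` is a scalar linear ODE
for the flux `|v| f`. Everything about the transport operator therefore reduces to accounting for
boundary fluxes. The pivot is `mem_transportGraph_iff`: after reversing `x` for negative velocities,
membership in the graph says that an ODE holds on almost every characteristic, with incoming fluxes
obtained from outgoing ones through the boundary operators.

Generation follows from Lumer–Phillips (`exists_generatorGraph_eq`), proved here by Yosida
approximation. Stochastic operators are `L¹` contractions, so the energy estimate for the ODE,
integrated over `v`, gives dissipativity (`transportGraph_dissipative`). Solving the resolvent
equation is a fixed point problem for the outgoing fluxes. It is a strict contraction because `|v| <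
1`, so each crossing takes time at least `2a` and damps the flux by at least `exp (-2al)`
(`transportGraph_range`). The domain is dense because it contains smooth functions vanishing at `x =
±a` (`transportGraph_dense`).

The invariant density is explicit: `|v|⁻¹ h` on positive and `|v|⁻¹ h'` on negative velocities,
constant in `x`. Such a function has zero streaming term, and its boundary conditions are exactly
the eigenpair equations (`exists_stationary_density`). An eigenpair exists because one of the two
boundary operators is weakly compact, so Cesàro means of densities have weak cluster points
(`exists_fixed_density`). The weight hypotheses make `|v|⁻¹ h` integrable: one boundary operator
gains the factor `|v|⁻¹` and the other preserves it (`IsEigenPair.invWeightIntegrable`). Finally, a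
vector killed by the generator is fixed by the semigroup. -/

namespace SlabTransport

/-! ### Resolvents of dissipative relations and exponentials of bounded operators. -/

section HilleYosida

variable {E : Type*} [NormedAddCommGroup E] [NormedSpace ℝ E]

/-- The resolvents of a dissipative relation satisfying the range condition. -/
theorem exists_resolvent (G : Submodule ℝ (E × E))
    (hdis : ∀ q ∈ G, ∀ l : ℝ, 0 < l → l * ‖q.1‖ ≤ ‖l • q.1 - q.2‖)
    (hrange : ∀ l : ℝ, 0 < l → ∀ h : E, ∃ q ∈ G, l • q.1 - q.2 = h) {l : ℝ} (hl : 0 < l) :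
    ∃ R : E →L[ℝ] E, ‖l • R‖ ≤ 1 ∧ (∀ h, (R h, l • R h - h) ∈ G) ∧
      ∀ q ∈ G, R (l • q.1 - q.2) = q.1 := by
  have huniq : ∀ q ∈ G, ∀ q' ∈ G, l • q.1 - q.2 = l • q'.1 - q'.2 → q.1 = q'.1 := by
    intro q hq q' hq' h
    have := hdis _ (G.sub_mem hq hq') l hl
    have e : l • (q - q').1 - (q - q').2 = 0 := by
      have : l • (q - q').1 - (q - q').2 = (l • q.1 - q.2) - (l • q'.1 - q'.2) := by
        simp only [Prod.fst_sub, Prod.snd_sub]; module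
      rw [this, h, sub_self]
    rw [e, norm_zero] at this
    have h0 : ‖(q - q').1‖ ≤ 0 := by
      by_contra hc
      push Not at hc
      nlinarith [mul_pos hl hc]
    exact sub_eq_zero.1 (norm_le_zero_iff.1 h0)
  choose r hrG hr using hrange l hl
  have hinv : ∀ q ∈ G, (r (l • q.1 - q.2)).1 = q.1 := fun q hq =>
    huniq _ (hrG _) _ hq (hr _)
  have hadd : ∀ x y, (r (x + y)).1 = (r x).1 + (r y).1 := by
    intro x y
    have := hinv _ (G.add_mem (hrG x) (hrG y))
    rw [← Prod.fst_add, ← this]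
    congr 2
    conv_lhs => rw [← hr x, ← hr y]
    simp only [Prod.fst_add, Prod.snd_add]; module
  have hsmul : ∀ (c : ℝ) x, (r (c • x)).1 = c • (r x).1 := by
    intro c x
    have := hinv _ (G.smul_mem c (hrG x))
    rw [← Prod.smul_fst, ← this]
    congr 2
    conv_lhs => rw [← hr x]
    simp only [Prod.smul_fst, Prod.smul_snd]; module
  let R₀ : E →ₗ[ℝ] E := { toFun := fun h => (r h).1, map_add' := hadd, map_smul' := hsmul }
  have hb : ∀ h, ‖R₀ h‖ ≤ l⁻¹ * ‖h‖ := by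
    intro h
    have := hdis _ (hrG h) l hl
    rw [hr h] at this
    rw [inv_mul_eq_div, le_div_iff₀ hl, mul_comm]
    exact this
  refine ⟨R₀.mkContinuous l⁻¹ hb, ?_, fun h => ?_, hinv⟩
  · rw [norm_smul, Real.norm_of_nonneg hl.le]
    have := R₀.mkContinuous_norm_le (by positivity) hb
    calc l * ‖R₀.mkContinuous l⁻¹ hb‖ ≤ l * l⁻¹ := by gcongr
      _ = 1 := mul_inv_cancel₀ hl.ne'
  · have : l • (r h).1 - h = (r h).2 := by
      conv_lhs => rw [← hr h]
      rw [hr h]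
      have := hr h
      rw [sub_eq_iff_eq_add] at this
      rw [this]; abel
    change ((r h).1, l • (r h).1 - h) ∈ G
    rw [this]
    exact hrG h

/-- This is the resolvent identity. Applying each resolvent to the graph point produced by the other
gives `(l - m) R Q + R = Q` and `(m - l) Q R + Q = R`; adding them leaves `(l - m)(R Q - Q R) = 0`.
-/
theorem commute_of_resolvent {G : Submodule ℝ (E × E)} {l m : ℝ} {R Q : E →L[ℝ] E}
    (hR : ∀ h, (R h, l • R h - h) ∈ G) (hR' : ∀ q ∈ G, R (l • q.1 - q.2) = q.1)
    (hQ : ∀ h, (Q h, m • Q h - h) ∈ G) (hQ' : ∀ q ∈ G, Q (m • q.1 - q.2) = q.1) :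
    Commute R Q := by
  by_cases hlm : l = m
  · subst hlm
    have : R = Q := by
      ext h
      have := hR' _ (hQ h)
      simpa using this
    rw [this]
  · ext h
    have h1 := hR' _ (hQ h)
    have h2 := hQ' _ (hR h)
    have e1 : l • Q h - (m • Q h - h) = (l - m) • Q h + h := by module
    have e2 : m • R h - (l • R h - h) = (m - l) • R h + h := by module
    simp only [e1, e2, map_add, map_smul] at h1 h2
    have h3 : (l - m) • (R (Q h) - Q (R h)) = 0 := by
      have : (l - m) • (R (Q h) - Q (R h)) = ((l - m) • R (Q h) + R h) +
        ((m - l) • Q (R h) + Q h) - R h - Q h := by module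
      rw [this, h1, h2]; abel
    exact sub_eq_zero.1 ((smul_eq_zero.1 h3).resolve_left (sub_ne_zero.2 hlm))

theorem norm_exp_le_real_exp_norm (B : E →L[ℝ] E) : ‖NormedSpace.exp B‖ ≤ Real.exp ‖B‖ := by
  rw [NormedSpace.exp_eq_tsum ℝ, Real.exp_eq_exp_ℝ, NormedSpace.exp_eq_tsum ℝ]
  have hs : Summable fun n : ℕ => ((n.factorial : ℝ)⁻¹) • ‖B‖ ^ n :=
    NormedSpace.expSeries_summable' (𝕂 := ℝ) ‖B‖
  refine tsum_of_norm_bounded hs.hasSum fun n => ?_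
  rw [norm_smul, norm_inv, Real.norm_natCast, smul_eq_mul]
  refine mul_le_mul_of_nonneg_left ?_ (by positivity)
  rcases n.eq_zero_or_pos with rfl | hn
  -- The zeroth power is separate: only `‖1‖ ≤ 1` is available, since `E` may be trivial.
  · simpa [ContinuousLinearMap.one_def] using (ContinuousLinearMap.norm_id_le : ‖ContinuousLinearMap.id ℝ E‖ ≤ 1)
  · exact norm_pow_le' B hn

variable [CompleteSpace E]

/-- Scalars commute with `B`, so the exponential equals `e^{-c} exp (c B)`, and the second factor
has norm at most `e^c`. This makes the Yosida approximants generate contractions. -/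
theorem norm_exp_smul_sub_one_le {B : E →L[ℝ] E} (hB : ‖B‖ ≤ 1) {c : ℝ} (hc : 0 ≤ c) :
    ‖NormedSpace.exp (c • (B - 1))‖ ≤ 1 := by
  let +nondep : NormedAlgebra ℚ (E →L[ℝ] E) := .restrictScalars ℚ ℝ _
  have e : c • (B - 1) = c • B + algebraMap ℝ (E →L[ℝ] E) (-c) := by
    rw [Algebra.algebraMap_eq_smul_one]; module
  rw [e, NormedSpace.exp_add_of_commute (Algebra.commutes _ _).symm,
    ← NormedSpace.algebraMap_exp_comm, ← Real.exp_eq_exp_ℝ, ← Algebra.commutes,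
    ← Algebra.smul_def, norm_smul, Real.norm_eq_abs, Real.abs_exp]
  calc Real.exp (-c) * ‖NormedSpace.exp (c • B)‖ ≤ Real.exp (-c) * Real.exp c := by
        gcongr
        refine (norm_exp_le_real_exp_norm _).trans (Real.exp_le_exp.2 ?_)
        rw [norm_smul, Real.norm_of_nonneg hc]
        nlinarith
    _ = 1 := by rw [← Real.exp_add]; simp

/-- The path `s ↦ exp (s A) exp ((t - s) B) f` joins the two vectors. By commutativity its
derivative is the same product of contractions applied to `(A - B) f`. -/
theorem norm_exp_sub_exp_apply_le {A B : E →L[ℝ] E} (hAB : Commute A B)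
    (hA : ∀ t : ℝ, 0 ≤ t → ‖NormedSpace.exp (t • A)‖ ≤ 1)
    (hB : ∀ t : ℝ, 0 ≤ t → ‖NormedSpace.exp (t • B)‖ ≤ 1) {t : ℝ} (ht : 0 ≤ t) (f : E) :
    ‖NormedSpace.exp (t • A) f - NormedSpace.exp (t • B) f‖ ≤ t * ‖A f - B f‖ := by
  have key : ∀ s : ℝ, NormedSpace.exp (t • B) * NormedSpace.exp (s • (A - B)) =
      NormedSpace.exp (s • A) * NormedSpace.exp ((t - s) • B) := by
    intro s
    let +nondep : NormedAlgebra ℚ (E →L[ℝ] E) := .restrictScalars ℚ ℝ _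
    rw [← NormedSpace.exp_add_of_commute, ← NormedSpace.exp_add_of_commute]
    · congr 1; module
    · exact (hAB.smul_left _).smul_right _
    · exact ((hAB.symm.sub_right (Commute.refl B)).smul_left _).smul_right _
  have hd : ∀ s : ℝ, HasDerivAt
      (fun s : ℝ => (NormedSpace.exp (t • B) * NormedSpace.exp (s • (A - B))) f)
      ((NormedSpace.exp (t • B) * NormedSpace.exp (s • (A - B))) ((A - B) f)) s := by
    intro s
    have := ((hasDerivAt_exp_smul_const (𝕂 := ℝ) (A - B) s).const_mul
      (NormedSpace.exp (t • B))).clm_apply (hasDerivAt_const s f)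
    simpa [mul_assoc] using this
  have := norm_image_sub_le_of_norm_deriv_le_segment' (a := 0) (b := t) (C := ‖A f - B f‖)
    (fun s _ => (hd s).hasDerivWithinAt) (fun s hs => ?_) t ⟨ht, le_rfl⟩
  · rw [key t, key 0] at this
    simpa [mul_comm] using this
  · rw [key s]
    refine (ContinuousLinearMap.le_opNorm _ _).trans ?_
    refine mul_le_of_le_one_left (norm_nonneg _) ?_
    refine (norm_mul_le _ _).trans ?_
    exact mul_le_one₀ (hA s hs.1) (norm_nonneg _) (hB _ (by linarith [hs.2]))

/-- The derivative of `exp (s A) f - s g` splits as `exp (s A) (A f - g) + (exp (s A) g - g)`. The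
bound depends on `A` only through `A f - g` and the orbit of `g`, so it survives passage to the
limit along Yosida approximants. -/
theorem norm_exp_apply_sub_sub_le {A : E →L[ℝ] E}
    (hA : ∀ t : ℝ, 0 ≤ t → ‖NormedSpace.exp (t • A)‖ ≤ 1) {t C : ℝ} (ht : 0 ≤ t) (f g : E)
    (hC : ∀ s, 0 ≤ s → s ≤ t → ‖NormedSpace.exp (s • A) g - g‖ ≤ C) :
    ‖NormedSpace.exp (t • A) f - f - t • g‖ ≤ (‖A f - g‖ + C) * t := by
  have hd : ∀ s : ℝ, HasDerivAt (fun s : ℝ => NormedSpace.exp (s • A) f - s • g)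
      (NormedSpace.exp (s • A) (A f) - g) s := by
    intro s
    have h1 := (hasDerivAt_exp_smul_const (𝕂 := ℝ) A s).clm_apply (hasDerivAt_const s f)
    have h2 := (hasDerivAt_id s).smul_const g
    simpa using h1.fun_sub h2
  have := norm_image_sub_le_of_norm_deriv_le_segment' (a := 0) (b := t) (C := ‖A f - g‖ + C)
    (fun s _ => (hd s).hasDerivWithinAt) (fun s hs => ?_) t ⟨ht, le_rfl⟩
  · simp only [zero_smul, sub_zero, NormedSpace.exp_zero, one_apply_eq_self] at this
    convert this using 2
    abel
  · have e : NormedSpace.exp (s • A) (A f) - g =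
        NormedSpace.exp (s • A) (A f - g) + (NormedSpace.exp (s • A) g - g) := by
      rw [map_sub]; abel
    rw [e]
    refine (norm_add_le _ _).trans (add_le_add ?_ (hC s hs.1 hs.2.le))
    exact (ContinuousLinearMap.le_opNorm _ _).trans
      (mul_le_of_le_one_left (norm_nonneg _) (hA s hs.1))

end HilleYosida

/-! ### Generators of semigroups and the Lumer–Phillips theorem. -/

section HilleYosidaGeneration

variable {E : Type*} [NormedAddCommGroup E] [NormedSpace ℝ E]

theorem C0Semigroup.op_apply_add (S : C0Semigroup E) (s t : ℝ≥0) (f : E) :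
    S.op (s + t) f = S.op s (S.op t f) := by
  rw [S.op_add]; rfl

theorem C0Semigroup.op_zero_apply (S : C0Semigroup E) (f : E) : S.op 0 f = f := by
  rw [S.op_zero]; rfl

theorem C0Semigroup.generatorGraph_sub (S : C0Semigroup E) {q r : E × E}
    (hq : q ∈ S.generatorGraph) (hr : r ∈ S.generatorGraph) : q - r ∈ S.generatorGraph := by
  have hq' : Tendsto _ _ _ := hq
  have hr' : Tendsto _ _ _ := hr
  refine (hq'.sub hr').congr fun t => ?_
  simp only [Prod.fst_sub, map_sub]
  module

/-- A vector annihilated by the generator is invariant under the semigroup. -/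
theorem C0Semigroup.op_eq_of_mem_generatorGraph (S : C0Semigroup E) {f : E}
    (hf : (f, (0 : E)) ∈ S.generatorGraph) (t : ℝ≥0) : S.op t f = f := by
  have hf' : Tendsto (fun t : ℝ≥0 => (t : ℝ)⁻¹ • (S.op t f - f)) (𝓝[>] 0) (𝓝 0) := hf
  have htn : Tendsto (fun x : ℝ => x.toNNReal) (𝓝[>] 0) (𝓝[>] (0 : ℝ≥0)) := by
    refine tendsto_nhdsWithin_iff.2 ⟨?_, ?_⟩
    · exact (continuous_real_toNNReal.tendsto' 0 0 (by simp)).mono_left nhdsWithin_le_nhds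
    · filter_upwards [self_mem_nhdsWithin] with t ht
      exact Real.toNNReal_pos.2 ht
  have hcont : Continuous fun x : ℝ => S.op x.toNNReal f :=
    (S.continuous_orbit f).comp continuous_real_toNNReal
  -- Right derivatives suffice for constancy, and the semigroup law transports the one at `0` to
  -- every `x`.
  have hder : ∀ x ∈ Ico (0 : ℝ) t,
      HasDerivWithinAt (fun x : ℝ => S.op x.toNNReal f) 0 (Ici x) x := by
    intro x hx
    rw [← hasDerivWithinAt_Ioi_iff_Ici, hasDerivWithinAt_iff_tendsto_slope' (by simp)]
    have h1 : Tendsto (fun y : ℝ => y - x) (𝓝[>] x) (𝓝[>] 0) := by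
      refine tendsto_nhdsWithin_iff.2 ⟨?_, ?_⟩
      · exact ((continuous_id.sub continuous_const).tendsto' x 0 (by simp)).mono_left
          nhdsWithin_le_nhds
      · filter_upwards [self_mem_nhdsWithin] with y hy
        exact mem_Ioi.2 (sub_pos.2 (mem_Ioi.1 hy))
    have h2 := ((S.op x.toNNReal).continuous.tendsto 0).comp (hf'.comp (htn.comp h1))
    rw [map_zero] at h2
    refine h2.congr' ?_
    filter_upwards [self_mem_nhdsWithin] with y hy
    have hxy : 0 ≤ y - x := (sub_pos.2 (mem_Ioi.1 hy)).le
    have e : y.toNNReal = x.toNNReal + (y - x).toNNReal := by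
      rw [← Real.toNNReal_add hx.1 hxy]; congr 1; ring
    simp only [Function.comp_apply, slope, vsub_eq_sub, map_smul, map_sub]
    rw [e, S.op_apply_add, Real.coe_toNNReal _ hxy]
  have := constant_of_has_deriv_right_zero hcont.continuousOn hder t ⟨t.2, le_rfl⟩
  simpa [S.op_zero_apply] using this

/-- The generator of a contraction semigroup is not a proper extension of a relation that satisfies
the range condition. -/
theorem C0Semigroup.generatorGraph_subset (S : C0Semigroup E) (hS : ∀ t f, ‖S.op t f‖ ≤ ‖f‖)
    {G : Set (E × E)} (hG : G ⊆ S.generatorGraph) (hrange : ∀ h : E, ∃ q ∈ G, q.1 - q.2 = h) :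
    S.generatorGraph ⊆ G := by
  intro q hq
  obtain ⟨r, hr, hrq⟩ := hrange (q.1 - q.2)
  have hd := S.generatorGraph_sub hq (hG hr)
  have e : (q - r).2 = (q - r).1 := by
    simp only [Prod.fst_sub, Prod.snd_sub]
    rw [sub_eq_sub_iff_add_eq_add] at hrq ⊢
    rw [add_comm, ← hrq, add_comm]
  -- The difference `d` satisfies `generator d = d`. Its orbit would then grow like `(1 + t) d` to
  -- first order, which contractivity forbids unless `d = 0`.
  set d := (q - r).1 with hd'
  have hlim : Tendsto (fun t : ℝ≥0 => (t : ℝ)⁻¹ • (S.op t d - d)) (𝓝[>] 0) (𝓝 d) := by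
    have : Tendsto (fun t : ℝ≥0 => (t : ℝ)⁻¹ • (S.op t (q - r).1 - (q - r).1)) (𝓝[>] 0)
      (𝓝 (q - r).2) := hd
    rwa [e] at this
  have hz : Tendsto (fun t : ℝ≥0 => ‖(t : ℝ)⁻¹ • (S.op t d - d) - d‖) (𝓝[>] 0) (𝓝 0) := by
    simpa using (hlim.sub_const d).norm
  have hle : ‖d‖ ≤ 0 := by
    refine ge_of_tendsto hz ?_
    filter_upwards [self_mem_nhdsWithin] with t ht
    have ht' : (0 : ℝ) < t := ht
    have h1 : (1 + (t : ℝ)) • d = S.op t d - (t : ℝ) • ((t : ℝ)⁻¹ • (S.op t d - d) - d) := by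
      rw [smul_sub, smul_smul, mul_inv_cancel₀ ht'.ne']; module
    have h2 : (1 + (t : ℝ)) * ‖d‖ ≤ ‖d‖ + t * ‖(t : ℝ)⁻¹ • (S.op t d - d) - d‖ := by
      calc (1 + (t : ℝ)) * ‖d‖ = ‖(1 + (t : ℝ)) • d‖ := by
            rw [norm_smul, Real.norm_of_nonneg (by positivity)]
        _ ≤ ‖S.op t d‖ + ‖(t : ℝ) • ((t : ℝ)⁻¹ • (S.op t d - d) - d)‖ := by
            rw [h1]; exact norm_sub_le _ _
        _ ≤ _ := by
            rw [norm_smul (t : ℝ), Real.norm_of_nonneg ht'.le]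
            gcongr
            exact hS t d
    have h3 : (t : ℝ) * ‖d‖ ≤ t * ‖(t : ℝ)⁻¹ • (S.op t d - d) - d‖ := by linarith
    exact le_of_mul_le_mul_left h3 ht'
  have hd0 : q - r = 0 := Prod.ext (norm_le_zero_iff.1 hle) (by
    rw [e]; exact norm_le_zero_iff.1 hle)
  rwa [sub_eq_zero.1 hd0]

variable [CompleteSpace E]

/-- The strong limit of the uniformly continuous contraction semigroups generated by commuting
bounded operators which converge pointwise on a dense set. -/
theorem exists_C0Semigroup_of_tendsto {A : ℕ → E →L[ℝ] E} (hcomm : ∀ m n, Commute (A m) (A n))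
    (hA : ∀ n (t : ℝ), 0 ≤ t → ‖NormedSpace.exp (t • A n)‖ ≤ 1) {G : Set (E × E)}
    (hdense : Dense (Prod.fst '' G))
    (hlim : ∀ q ∈ G, Tendsto (fun n => A n q.1) atTop (𝓝 q.2)) :
    ∃ S : C0Semigroup E, (∀ t f, ‖S.op t f‖ ≤ ‖f‖) ∧ G ⊆ S.generatorGraph := by
  set U : ℕ → ℝ≥0 → E →L[ℝ] E := fun n t => NormedSpace.exp ((t : ℝ) • A n) with hU
  have hUle : ∀ n t f, ‖U n t f‖ ≤ ‖f‖ := fun n t f =>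
    (ContinuousLinearMap.le_opNorm _ _).trans
      (mul_le_of_le_one_left (norm_nonneg _) (hA n t t.2))
  have hcauchy : ∀ (f : E) (T : ℝ≥0), UniformCauchySeqOn (fun n t => U n t f) atTop (Iic T) := by
    intro f T
    rw [Metric.uniformCauchySeqOn_iff]
    intro ε hε
    obtain ⟨_, ⟨q, hq, rfl⟩, hfq⟩ := hdense.exists_dist_lt f (show 0 < ε / 4 by linarith)
    obtain ⟨N, hN⟩ := Metric.cauchySeq_iff.1 (hlim q hq).cauchySeq (ε / (4 * (T + 1)))
      (by positivity)
    refine ⟨N, fun m hm n hn t ht => ?_⟩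
    have hT : (t : ℝ) ≤ T := NNReal.coe_le_coe.2 ht
    have h1 : ‖U m t f - U m t q.1‖ < ε / 4 := by
      rw [← map_sub]
      exact (hUle _ _ _).trans_lt (by rwa [← dist_eq_norm])
    have h2 : ‖U n t f - U n t q.1‖ < ε / 4 := by
      rw [← map_sub]
      exact (hUle _ _ _).trans_lt (by rwa [← dist_eq_norm])
    -- On domain vectors the approximating semigroups are compared through their generators;
    -- contractivity carries the estimate to all of `E`.
    have h3 : ‖U m t q.1 - U n t q.1‖ ≤ ε / 4 := by
      refine (norm_exp_sub_exp_apply_le (hcomm m n) (hA m) (hA n) t.2 q.1).trans ?_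
      have := (hN m hm n hn).le
      rw [dist_eq_norm] at this
      calc (t : ℝ) * ‖A m q.1 - A n q.1‖ ≤ (T + 1) * (ε / (4 * (T + 1))) := by
            gcongr
            linarith
        _ = ε / 4 := by field_simp
    rw [dist_eq_norm]
    have e : U m t f - U n t f = (U m t f - U m t q.1) + (U m t q.1 - U n t q.1)
      - (U n t f - U n t q.1) := by abel
    rw [e]
    calc _ ≤ ‖U m t f - U m t q.1‖ + ‖U m t q.1 - U n t q.1‖ + ‖U n t f - U n t q.1‖ :=
          (norm_sub_le _ _).trans (add_le_add_left (norm_add_le _ _) _)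
      _ < ε := by linarith
  have hex : ∀ (t : ℝ≥0) (f : E), ∃ y, Tendsto (fun n => U n t f) atTop (𝓝 y) := fun t f =>
    cauchySeq_tendsto_of_complete ((hcauchy f t).cauchySeq (mem_Iic.2 le_rfl))
  choose L hL using hex
  set V : ℝ≥0 → E →L[ℝ] E := fun t =>
    continuousLinearMapOfTendsto (fun n => U n t) (tendsto_pi_nhds.2 (hL t)) with hV
  have hV' : ∀ t f, Tendsto (fun n => U n t f) atTop (𝓝 (V t f)) := hL
  have hVle : ∀ t f, ‖V t f‖ ≤ ‖f‖ := fun t f =>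
    le_of_tendsto (hV' t f).norm (Eventually.of_forall fun n => hUle n t f)
  have hunif : ∀ f T, TendstoUniformlyOn (fun n t => U n t f) (fun t => V t f) atTop (Iic T) :=
    fun f T => (hcauchy f T).tendstoUniformlyOn_of_tendsto fun t _ => hV' t f
  have hUcont : ∀ n f, Continuous fun t : ℝ≥0 => U n t f := fun n f =>
    ((differentiable_exp_smul_const ℝ (A n)).continuous.comp NNReal.continuous_coe).clm_apply
      continuous_const
  have hVcont : ∀ f, Continuous fun t => V t f := by
    intro f
    rw [continuous_iff_continuousAt]
    intro t
    have := (hunif f (t + 1)).continuousOn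
      (Frequently.of_forall fun n => (hUcont n f).continuousOn)
    exact this.continuousAt (Iic_mem_nhds (lt_add_one t))
  have hUadd : ∀ n s t f, U n (s + t) f = U n s (U n t f) := by
    intro n s t f
    let +nondep : NormedAlgebra ℚ (E →L[ℝ] E) := .restrictScalars ℚ ℝ _
    simp only [hU, NNReal.coe_add, add_smul]
    rw [NormedSpace.exp_add_of_commute (((Commute.refl _).smul_left _).smul_right _)]
    rfl
  let S : C0Semigroup E :=
    { op := V
      op_zero := by
        ext f
        refine tendsto_nhds_unique (hV' 0 f) ?_
        simp [hU]
      op_add := by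
        intro s t
        ext f
        refine tendsto_nhds_unique (hV' (s + t) f) ?_
        have h1 : Tendsto (fun n => U n s (U n t f - V t f)) atTop (𝓝 0) := by
          refine squeeze_zero_norm (fun n => hUle n s _) ?_
          simpa using ((hV' t f).sub_const (V t f)).norm
        have h2 := h1.add (hV' s (V t f))
        rw [zero_add] at h2
        refine h2.congr fun n => ?_
        rw [hUadd, map_sub, sub_add_cancel]
      continuous_orbit := hVcont }
  refine ⟨S, hVle, fun q hq => ?_⟩
  change Tendsto (fun t : ℝ≥0 => (t : ℝ)⁻¹ • (V t q.1 - q.1)) (𝓝[>] 0) (𝓝 q.2)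
  have hV0 : V 0 q.2 = q.2 := S.op_zero_apply q.2
  rw [Metric.tendsto_nhds]
  intro ε hε
  have hnear : ∀ᶠ t in 𝓝 (0 : ℝ≥0), ‖V t q.2 - q.2‖ < ε / 4 := by
    have := Metric.tendsto_nhds.1 ((hVcont q.2).tendsto 0) (ε / 4) (by linarith)
    simpa only [hV0, dist_eq_norm] using this
  obtain ⟨δ, hδ, hδ'⟩ := (nhds_bot_basis_Iic (α := ℝ≥0)).eventually_iff.1 (by simpa using hnear)
  filter_upwards [self_mem_nhdsWithin, nhdsWithin_le_nhds (Iic_mem_nhds hδ)] with t ht htδ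
  have ht' : (0 : ℝ) < t := ht
  -- The three quarters come from `A n q.1 ≈ q.2`, from uniform convergence of the orbit of `q.2`,
  -- and from continuity of its limit at time `0`.
  have hev : ∀ᶠ n in atTop, ‖U n t q.1 - q.1 - (t : ℝ) • q.2‖ ≤ 3 * ε / 4 * t := by
    have h1 := Metric.tendstoUniformlyOn_iff.1 (hunif q.2 t) (ε / 4) (by linarith)
    have h2 := Metric.tendsto_nhds.1 (hlim q hq) (ε / 4) (by linarith)
    filter_upwards [h1, h2] with n h1 h2
    have h3 := norm_exp_apply_sub_sub_le (A := A n) (hA n) (C := ε / 2) t.2 q.1 q.2 ?_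
    · refine h3.trans (mul_le_mul_of_nonneg_right ?_ t.2)
      rw [dist_eq_norm] at h2
      linarith
    · intro s hs hst
      have h4 := h1 ⟨s, hs⟩ (show (⟨s, hs⟩ : ℝ≥0) ≤ t from hst)
      have h5 := @hδ' ⟨s, hs⟩ ((show (⟨s, hs⟩ : ℝ≥0) ≤ t from hst).trans htδ)
      rw [dist_eq_norm, norm_sub_rev] at h4
      have e : NormedSpace.exp (s • A n) q.2 - q.2 =
          (U n ⟨s, hs⟩ q.2 - V ⟨s, hs⟩ q.2) + (V ⟨s, hs⟩ q.2 - q.2) := by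
        change U n ⟨s, hs⟩ q.2 - q.2 = _
        abel
      rw [e]
      refine (norm_add_le _ _).trans ?_
      linarith
  have hle : ‖V t q.1 - q.1 - (t : ℝ) • q.2‖ ≤ 3 * ε / 4 * t :=
    le_of_tendsto (((hV' t q.1).sub_const q.1).sub_const ((t : ℝ) • q.2)).norm hev
  have e : (t : ℝ)⁻¹ • (V t q.1 - q.1) - q.2 =
      (t : ℝ)⁻¹ • (V t q.1 - q.1 - (t : ℝ) • q.2) := by
    rw [smul_sub _ _ ((t : ℝ) • q.2), smul_smul, inv_mul_cancel₀ ht'.ne', one_smul]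
  rw [dist_eq_norm, e, norm_smul, norm_inv, Real.norm_of_nonneg ht'.le, inv_mul_lt_iff₀ ht']
  nlinarith

/-- The **Lumer–Phillips theorem**: a densely defined dissipative operator satisfying the range
condition generates a strongly continuous semigroup. -/
theorem exists_generatorGraph_eq (G : Submodule ℝ (E × E))
    (hdense : Dense (Prod.fst '' (G : Set (E × E))))
    (hdis : ∀ q ∈ G, ∀ l : ℝ, 0 < l → l * ‖q.1‖ ≤ ‖l • q.1 - q.2‖)
    (hrange : ∀ l : ℝ, 0 < l → ∀ h : E, ∃ q ∈ G, l • q.1 - q.2 = h) :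
    ∃ S : C0Semigroup E, S.generatorGraph = G := by
  have hpos : ∀ n : ℕ, (0 : ℝ) < n + 1 := fun n => by positivity
  choose R hR1 hR hR' using fun n : ℕ => exists_resolvent G hdis hrange (hpos n)
  -- With `λ = n + 1`, `B n` is `λ R(λ)`, which tends strongly to the identity, and `λ (λ R(λ) - 1)`
  -- below is the Yosida approximation of the generator.
  set B : ℕ → E →L[ℝ] E := fun n => ((n : ℝ) + 1) • R n with hB
  have hstep : ∀ q ∈ G, ∀ n, B n q.1 - q.1 = R n q.2 := by
    intro q hq n
    have := hR' n q hq
    rw [map_sub, map_smul] at this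
    simp only [hB, smul_apply]
    nth_rewrite 2 [← this]
    abel
  have hBle : ∀ n f, ‖B n f‖ ≤ ‖f‖ := fun n f =>
    (ContinuousLinearMap.le_opNorm _ _).trans (mul_le_of_le_one_left (norm_nonneg _) (hR1 n))
  have hRle : ∀ n f, ‖R n f‖ ≤ ((n : ℝ) + 1)⁻¹ * ‖f‖ := by
    intro n f
    have := hBle n f
    simp only [hB, smul_apply, norm_smul,
      Real.norm_of_nonneg (hpos n).le] at this
    rw [inv_mul_eq_div, le_div_iff₀ (hpos n), mul_comm]
    exact this
  have hBD : ∀ q ∈ G, Tendsto (fun n => B n q.1) atTop (𝓝 q.1) := by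
    intro q hq
    rw [tendsto_iff_norm_sub_tendsto_zero]
    have h0 : Tendsto (fun n : ℕ => ((n : ℝ) + 1)⁻¹ * ‖q.2‖) atTop (𝓝 0) := by
      have := (tendsto_one_div_add_atTop_nhds_zero_nat (𝕜 := ℝ)).mul_const ‖q.2‖
      simpa using this
    refine squeeze_zero (fun _ => norm_nonneg _) (fun n => ?_) h0
    rw [hstep q hq]
    exact hRle n _
  have hBlim : ∀ f, Tendsto (fun n => B n f) atTop (𝓝 f) := by
    intro f
    rw [Metric.tendsto_nhds]
    intro ε hε
    obtain ⟨_, ⟨q, hq, rfl⟩, hfq⟩ := hdense.exists_dist_lt f (show 0 < ε / 4 by linarith)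
    filter_upwards [Metric.tendsto_nhds.1 (hBD q hq) (ε / 4) (by linarith)] with n hn
    have h1 : dist (B n f) (B n q.1) < ε / 4 := by
      rw [dist_eq_norm, ← map_sub]
      exact (hBle _ _).trans_lt (by rwa [← dist_eq_norm])
    have h2 := dist_triangle4 (B n f) (B n q.1) q.1 f
    rw [dist_comm q.1 f] at h2
    linarith
  set A : ℕ → E →L[ℝ] E := fun n => ((n : ℝ) + 1) • (B n - 1) with hA
  have hcomm : ∀ m n, Commute (A m) (A n) := by
    intro m n
    have h := commute_of_resolvent (hR m) (hR' m) (hR n) (hR' n)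
    have h1 : Commute (B m) (B n) := (h.smul_left _).smul_right _
    exact (((h1.sub_left (Commute.one_left _)).sub_right
      (Commute.one_right _)).smul_left _).smul_right _
  have hcontr : ∀ n (t : ℝ), 0 ≤ t → ‖NormedSpace.exp (t • A n)‖ ≤ 1 := by
    intro n t ht
    simp only [hA, smul_smul]
    exact norm_exp_smul_sub_one_le (hR1 n) (mul_nonneg ht (hpos n).le)
  have hlim : ∀ q ∈ (G : Set (E × E)), Tendsto (fun n => A n q.1) atTop (𝓝 q.2) := by
    intro q hq
    refine (hBlim q.2).congr fun n => ?_
    simp only [hA, smul_apply, sub_apply,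
      one_apply_eq_self]
    rw [hstep q hq]
    rfl
  obtain ⟨S, hS, hGS⟩ := exists_C0Semigroup_of_tendsto hcomm hcontr hdense hlim
  refine ⟨S, (S.generatorGraph_subset hS hGS fun h => ?_).antisymm hGS⟩
  simpa using hrange 1 one_pos h

end HilleYosidaGeneration

/-! ### Additivity of the `L¹` norm on the positive cone. -/

section LpOne

variable {α : Type*} [MeasurableSpace α] {μ : Measure α}

theorem norm_eq_integral_of_nonneg {f : Lp ℝ 1 μ} (hf : 0 ≤ f) : ‖f‖ = ∫ x, f x ∂μ := by
  rw [L1.norm_eq_integral_norm]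
  refine integral_congr_ae ?_
  filter_upwards [(Lp.coeFn_nonneg f).2 hf] with x hx
  exact Real.norm_of_nonneg hx

theorem integral_eq_integralCLM (f : Lp ℝ 1 μ) :
    ∫ x, f x ∂μ = (L1.integralCLM : Lp ℝ 1 μ →L[ℝ] ℝ) f := by
  rw [← L1.integral_eq, L1.integral_eq_integral]

theorem norm_add_of_nonneg {f g : Lp ℝ 1 μ} (hf : 0 ≤ f) (hg : 0 ≤ g) :
    ‖f + g‖ = ‖f‖ + ‖g‖ := by
  rw [norm_eq_integral_of_nonneg hf, norm_eq_integral_of_nonneg hg,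
    norm_eq_integral_of_nonneg (add_nonneg hf hg)]
  simp only [integral_eq_integralCLM, map_add]

theorem smul_nonneg_of_nonneg {c : ℝ} (hc : 0 ≤ c) {f : Lp ℝ 1 μ} (hf : 0 ≤ f) : 0 ≤ c • f := by
  rw [← Lp.coeFn_nonneg] at hf ⊢
  filter_upwards [hf, Lp.coeFn_smul c f] with x hx hs
  rw [hs]
  exact mul_nonneg hc hx

end LpOne

/-! ### Stochastic operators, fixed densities and integrability against the weight `|v|⁻¹`. -/

section Stochastic

variable {I J : Set ℝ}

/-- Split `f` into positive and negative parts: `K` preserves the norm of each, and in `L¹` these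
norms add up to `‖f‖`. -/
theorem IsStochastic.norm_apply_le {K : L1 I →L[ℝ] L1 J} (hK : IsStochastic K) (f : L1 I) :
    ‖K f‖ ≤ ‖f‖ := by
  calc ‖K f‖ = ‖K f⁺ - K f⁻‖ := by rw [← map_sub, posPart_sub_negPart]
    _ ≤ ‖K f⁺‖ + ‖K f⁻‖ := norm_sub_le _ _
    _ = ‖f⁺ + f⁻‖ := by
        rw [(hK _ (posPart_nonneg f)).2, (hK _ (negPart_nonneg f)).2,
          norm_add_of_nonneg (posPart_nonneg f) (negPart_nonneg f)]
    _ = ‖f‖ := by rw [posPart_add_negPart, norm_abs_eq_norm]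

theorem IsStochastic.convexCombination {K R : L1 I →L[ℝ] L1 J} (hR : IsStochastic R)
    (hK : IsStochastic K) {α β : ℝ} (hα : 0 ≤ α) (hβ : 0 ≤ β) (h : α + β = 1) :
    IsStochastic (α • R + β • K) := by
  intro f hf
  have h1 := smul_nonneg_of_nonneg hα (hR f hf).1
  have h2 := smul_nonneg_of_nonneg hβ (hK f hf).1
  refine ⟨add_nonneg h1 h2, ?_⟩
  change ‖α • R f + β • K f‖ = ‖f‖
  rw [norm_add_of_nonneg h1 h2, norm_smul, norm_smul, (hR f hf).2, (hK f hf).2,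
    Real.norm_of_nonneg hα, Real.norm_of_nonneg hβ, ← add_mul, h, one_mul]

theorem R₁_coeFn (f : L1 Ineg) :
    R₁ f =ᵐ[(volume : Measure ℝ).restrict Ipos] fun v => f (-v) :=
  Lp.coeFn_compMeasurePreserving f measurePreserving_neg_pos_neg

theorem R₂_coeFn (f : L1 Ipos) :
    R₂ f =ᵐ[(volume : Measure ℝ).restrict Ineg] fun v => f (-v) :=
  Lp.coeFn_compMeasurePreserving f measurePreserving_neg_neg_pos

theorem isStochastic_R₁ : IsStochastic R₁ := by
  refine fun f hf => ⟨?_, LinearIsometry.norm_map _ f⟩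
  rw [← Lp.coeFn_nonneg] at hf ⊢
  filter_upwards [R₁_coeFn f, measurePreserving_neg_pos_neg.quasiMeasurePreserving.ae hf]
    with v h1 h2
  rw [h1]
  exact h2

theorem isStochastic_R₂ : IsStochastic R₂ := by
  refine fun f hf => ⟨?_, LinearIsometry.norm_map _ f⟩
  rw [← Lp.coeFn_nonneg] at hf ⊢
  filter_upwards [R₂_coeFn f, measurePreserving_neg_neg_pos.quasiMeasurePreserving.ae hf]
    with v h1 h2
  rw [h1]
  exact h2

theorem exists_nonneg_norm_eq_one_pos : ∃ f : L1 Ipos, 0 ≤ f ∧ ‖f‖ = 1 := by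
  have hm : MemLp (fun _ : ℝ => (1 : ℝ)) 1 ((volume : Measure ℝ).restrict Ipos) :=
    memLp_const 1
  have h0 : 0 ≤ hm.toLp := by
    rw [← Lp.coeFn_nonneg]
    filter_upwards [hm.coeFn_toLp] with x hx
    rw [hx]
    exact zero_le_one
  refine ⟨hm.toLp, h0, ?_⟩
  rw [norm_eq_integral_of_nonneg h0, integral_congr_ae hm.coeFn_toLp]
  simp

/-- A weakly compact stochastic operator composed with a stochastic operator has an invariant
density: any weak cluster point of the Cesàro means of an orbit. -/
theorem exists_fixed_density {P : L1 I →L[ℝ] L1 J} {Q : L1 J →L[ℝ] L1 I} (hP : IsStochastic P)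
    (hQ : IsStochastic Q) (hQw : IsWeaklyCompact Q) {f₀ : L1 I} (hf₀ : 0 ≤ f₀)
    (hf₀' : ‖f₀‖ = 1) : ∃ h : L1 I, 0 ≤ h ∧ ‖h‖ = 1 ∧ Q (P h) = h := by
  set G : L1 I →L[ℝ] L1 I := Q.comp P with hG
  set C : Set (L1 I) := {h | 0 ≤ h ∧ ‖h‖ = 1} with hC
  have hGC : ∀ h ∈ C, G h ∈ C := fun h hh =>
    ⟨(hQ _ (hP h hh.1).1).1, by
      rw [hG, ContinuousLinearMap.comp_apply, (hQ _ (hP h hh.1).1).2, (hP h hh.1).2, hh.2]⟩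
  have hCc : C = {h | 0 ≤ h ∧ (L1.integralCLM : L1 I →L[ℝ] ℝ) h = 1} := by
    ext h
    refine and_congr_right fun hh => ?_
    rw [norm_eq_integral_of_nonneg hh, integral_eq_integralCLM]
  have hCconv : Convex ℝ C := by
    rw [hCc]
    intro x hx y hy s t hs ht hst
    refine ⟨add_nonneg (smul_nonneg_of_nonneg hs hx.1) (smul_nonneg_of_nonneg ht hy.1), ?_⟩
    simp [hx.2, hy.2, hst]
  have hCclosed : IsClosed C :=
    (isClosed_Ici (a := (0 : L1 I))).inter (isClosed_eq continuous_norm continuous_const)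
  have hit : ∀ n, G^[n] f₀ ∈ C := fun n => by
    induction n with
    | zero => exact ⟨hf₀, hf₀'⟩
    | succ n ih => rw [Function.iterate_succ_apply']; exact hGC _ ih
  -- There are `n + 1` terms because the empty average is `0`, which is not a density.
  set b : ℕ → L1 I := fun n => birkhoffAverage ℝ G id (n + 1) f₀ with hb
  have hbC : ∀ n, b n ∈ C := by
    intro n
    simp only [hb, birkhoffAverage, birkhoffSum, id]
    rw [Finset.smul_sum]
    refine hCconv.sum_mem (fun _ _ => by positivity) ?_ fun i _ => hit i
    simp
    field_simp
  have hGb : Tendsto (fun n => G (b n) - b n) atTop (𝓝 0) := by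
    have h1 : Bornology.IsBounded (range fun n => id (G^[n] f₀)) := by
      refine isBounded_iff_forall_norm_le.2 ⟨1, ?_⟩
      rintro _ ⟨n, rfl⟩
      exact (hit n).2.le
    have h2 := (tendsto_birkhoffAverage_apply_sub_birkhoffAverage ℝ h1).comp
      (tendsto_add_atTop_nat 1)
    refine h2.congr fun n => ?_
    simp only [Function.comp_apply, hb]
    congr 1
    simp only [birkhoffAverage, birkhoffSum, id, map_smul, map_sum]
    congr 1
    refine Finset.sum_congr rfl fun i _ => ?_
    rw [← Function.iterate_succ_apply, Function.iterate_succ_apply']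
  -- Applying `G` once more puts the averages in the image of the unit ball under `Q`, hence in a
  -- weakly compact set, and keeps them asymptotically invariant.
  set c : ℕ → L1 I := fun n => G (b n) with hc
  have hcC : ∀ n, c n ∈ C := fun n => hGC _ (hbC n)
  have hGc : Tendsto (fun n => (G - 1) (c n)) atTop (𝓝 0) := by
    have := (G.continuous.tendsto 0).comp hGb
    rw [map_zero] at this
    refine this.congr fun n => ?_
    simp [hc]
  have hcK : ∀ n, toWeakSpace ℝ (L1 I) (c n) ∈
      closure (toWeakSpace ℝ (L1 I) '' (Q '' Metric.closedBall 0 1)) := by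
    intro n
    refine subset_closure ⟨c n, ⟨P (b n), ?_, rfl⟩, rfl⟩
    rw [mem_closedBall_zero_iff, (hP _ (hbC n).1).2, (hbC n).2]
  obtain ⟨w, -, hw⟩ := hQw.exists_mapClusterPt (f := atTop)
    (u := fun n => toWeakSpace ℝ (L1 I) (c n)) (by
      rw [le_principal_iff, mem_map]
      exact Eventually.of_forall hcK)
  obtain ⟨U, hU, hUw⟩ := mapClusterPt_iff_ultrafilter.1 hw
  set h : L1 I := (toWeakSpace ℝ (L1 I)).symm w with hh
  have hwh : toWeakSpace ℝ (L1 I) h = w := (toWeakSpace ℝ (L1 I)).apply_symm_apply w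
  -- Mazur: a norm closed convex set is weakly closed. The set `C` is convex because on the positive
  -- cone the norm is the linear functional given by the integral.
  have hcl : IsClosed (toWeakSpace ℝ (L1 I) '' C) := by
    have := hCconv.toWeakSpace_closure (𝕜 := ℝ)
    rw [hCclosed.closure_eq] at this
    rw [this]
    exact isClosed_closure
  have hhC : h ∈ C := by
    have := hcl.mem_of_tendsto hUw (Eventually.of_forall fun n => mem_image_of_mem _ (hcC n))
    rw [← hwh] at this
    exact (toWeakSpace ℝ (L1 I)).injective.mem_set_image.1 this
  refine ⟨h, hhC.1, hhC.2, ?_⟩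
  have hfix : (G - 1) h = 0 := by
    refine SeparatingDual.eq_zero_of_forall_dual_eq_zero (R := ℝ) fun l => ?_
    have h1 : Tendsto (fun n => (l.comp (G - 1)) (c n)) U (𝓝 ((l.comp (G - 1)) h)) :=
      ((WeakBilin.eval_continuous (topDualPairing ℝ (L1 I)).flip (l.comp (G - 1))).tendsto w).comp
        hUw
    have h2 : Tendsto (fun n => (l.comp (G - 1)) (c n)) U (𝓝 0) := by
      have := (l.continuous.tendsto 0).comp hGc
      rw [map_zero] at this
      exact this.mono_left hU
    exact tendsto_nhds_unique h1 h2
  rw [sub_apply, one_apply_eq_self, sub_eq_zero] at hfix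
  exact hfix

/-- `|v|⁻¹ h` is integrable. -/
def InvWeightIntegrable (h : L1 I) : Prop :=
  ∃ g : L1 I, ∀ᵐ v ∂((volume : Measure ℝ).restrict I), g v = |v|⁻¹ * h v

theorem InvWeightIntegrable.lintegral_lt_top {h : L1 I} (hh : InvWeightIntegrable h) :
    ∫⁻ v in I, ENNReal.ofReal (h v / |v|) < ∞ := by
  obtain ⟨g, hg⟩ := hh
  have : ∫⁻ v in I, ENNReal.ofReal (h v / |v|) = ∫⁻ v in I, ENNReal.ofReal (g v) := by
    refine lintegral_congr_ae ?_
    filter_upwards [hg] with v hv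
    rw [hv, div_eq_inv_mul]
  rw [this]
  exact (L1.integrable_coeFn g).lintegral_lt_top

/-- Writing `h = |v| g` with `g` integrable, `|v|⁻¹ K h` is the bounded operator `|v|⁻¹ K |v|`
applied to `g`. -/
theorem ConjWeightBounded.invWeightIntegrable {K : L1 I →L[ℝ] L1 J} (hK : ConjWeightBounded K)
    (hI : ∀ᵐ v ∂((volume : Measure ℝ).restrict I), v ≠ 0) {h : L1 I}
    (hh : InvWeightIntegrable h) : InvWeightIntegrable (K h) := by
  obtain ⟨B, hB⟩ := hK
  obtain ⟨g, hg⟩ := hh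
  refine ⟨B g, hB g h ?_⟩
  filter_upwards [hg, hI] with v hv hv0
  rw [hv, mul_inv_cancel_left₀ (abs_ne_zero.2 hv0)]

theorem InvWeightIntegrable.linearCombination {h k : L1 I} (hh : InvWeightIntegrable h)
    (hk : InvWeightIntegrable k) (α β : ℝ) : InvWeightIntegrable (α • h + β • k) := by
  obtain ⟨g, hg⟩ := hh
  obtain ⟨l, hl⟩ := hk
  refine ⟨α • g + β • l, ?_⟩
  filter_upwards [hg, hl, Lp.coeFn_add (α • g) (β • l), Lp.coeFn_add (α • h) (β • k),
    Lp.coeFn_smul α g, Lp.coeFn_smul β l, Lp.coeFn_smul α h, Lp.coeFn_smul β k]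
    with v h1 h2 h3 h4 h5 h6 h7 h8
  simp only [h3, h4, Pi.add_apply, h5, h6, h7, h8, Pi.smul_apply, h1, h2, smul_eq_mul]
  ring

theorem InvWeightIntegrable.R₁ {h : L1 Ineg} (hh : InvWeightIntegrable h) :
    InvWeightIntegrable (R₁ h) := by
  obtain ⟨g, hg⟩ := hh
  refine ⟨SlabTransport.R₁ g, ?_⟩
  filter_upwards [R₁_coeFn g, R₁_coeFn h,
    measurePreserving_neg_pos_neg.quasiMeasurePreserving.ae hg] with v h1 h2 h3
  rw [h1, h2, h3, abs_neg]

theorem InvWeightIntegrable.R₂ {h : L1 Ipos} (hh : InvWeightIntegrable h) :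
    InvWeightIntegrable (R₂ h) := by
  obtain ⟨g, hg⟩ := hh
  refine ⟨SlabTransport.R₂ g, ?_⟩
  filter_upwards [R₂_coeFn g, R₂_coeFn h,
    measurePreserving_neg_neg_pos.quasiMeasurePreserving.ae hg] with v h1 h2 h3
  rw [h1, h2, h3, abs_neg]

theorem ae_ne_zero_Ipos : ∀ᵐ v ∂((volume : Measure ℝ).restrict Ipos), v ≠ 0 := by
  filter_upwards [ae_restrict_mem measurableSet_Ioo] with v hv using hv.1.ne'

theorem ae_ne_zero_Ineg : ∀ᵐ v ∂((volume : Measure ℝ).restrict Ineg), v ≠ 0 := by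
  filter_upwards [ae_restrict_mem measurableSet_Ioo] with v hv using hv.2.ne

theorem integrabilityCondition_of_invWeightIntegrable {h : L1 Ipos} {h' : L1 Ineg}
    (hh : InvWeightIntegrable h) (hh' : InvWeightIntegrable h') : IntegrabilityCondition h h' := by
  refine ENNReal.add_lt_top.2 ⟨?_, hh'.lintegral_lt_top⟩
  refine lt_of_eq_of_lt ?_ hh.lintegral_lt_top
  refine setLIntegral_congr_fun measurableSet_Ioo fun v hv => ?_
  rw [abs_of_pos hv.1]

section Boundary

variable {α₁ β₁ α₂ β₂ : ℝ} {K₁ : L1 Ineg →L[ℝ] L1 Ipos} {K₂ : L1 Ipos →L[ℝ] L1 Ineg}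

theorem isStochastic_O₁ (hα₁ : 0 ≤ α₁) (hβ₁ : 0 ≤ β₁) (h : α₁ + β₁ = 1) (hK : IsStochastic K₁) :
    IsStochastic (O₁ α₁ β₁ K₁) :=
  isStochastic_R₁.convexCombination hK hα₁ hβ₁ h

theorem isStochastic_O₂ (hα₂ : 0 ≤ α₂) (hβ₂ : 0 ≤ β₂) (h : α₂ + β₂ = 1) (hK : IsStochastic K₂) :
    IsStochastic (O₂ α₂ β₂ K₂) :=
  isStochastic_R₂.convexCombination hK hα₂ hβ₂ h

/-- The fixed density is sought on the side where the weakly compact operator acts last; the other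
member of the pair is its image under the other operator. -/
theorem exists_isEigenPair {P₁ : L1 Ineg →L[ℝ] L1 Ipos} {P₂ : L1 Ipos →L[ℝ] L1 Ineg}
    (hP₁ : IsStochastic P₁) (hP₂ : IsStochastic P₂)
    (hw : IsWeaklyCompact P₁ ∨ IsWeaklyCompact P₂) : ∃ h h', IsEigenPair P₁ P₂ h h' := by
  obtain ⟨f, hf, hf1⟩ := exists_nonneg_norm_eq_one_pos
  have hne : ∀ h : L1 Ipos, ‖h‖ = 1 → h ≠ 0 := by
    rintro h h1 rfl
    simp at h1
  rcases hw with hw | hw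
  · obtain ⟨h, h0, h1, hfix⟩ := exists_fixed_density hP₂ hP₁ hw hf hf1
    exact ⟨h, P₂ h, h0, (hP₂ h h0).1, hne h h1, rfl, hfix⟩
  · obtain ⟨h, h0, h1, hfix⟩ := exists_fixed_density hP₁ hP₂ hw (isStochastic_R₂ f hf).1
      ((isStochastic_R₂ f hf).2.trans hf1)
    exact ⟨P₁ h, h, (hP₁ h h0).1, h0, hne _ ((hP₁ h h0).2.trans h1), hfix, rfl⟩

/-- The purely diffuse wall has a regularizing operator, so the density leaving it is integrable
against `|v|⁻¹`. At the other wall reflection preserves `|v|`, and the conjugated bound handles the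
diffuse part, so the partner inherits this integrability. -/
theorem IsEigenPair.invWeightIntegrable {h : L1 Ipos} {h' : L1 Ineg}
    (hyp : (O₁ α₁ β₁ K₁ = K₁ ∧ InvWeightBounded K₁ ∧ ConjWeightBounded K₂) ∨
      (O₂ α₂ β₂ K₂ = K₂ ∧ InvWeightBounded K₂ ∧ ConjWeightBounded K₁))
    (hh : IsEigenPair (O₁ α₁ β₁ K₁) (O₂ α₂ β₂ K₂) h h') :
    InvWeightIntegrable h ∧ InvWeightIntegrable h' := by
  rcases hyp with ⟨hO, ⟨B, hB⟩, hc⟩ | ⟨hO, ⟨B, hB⟩, hc⟩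
  · have h1 : InvWeightIntegrable h := by
      rw [← hh.map_h', hO]
      exact ⟨B h', hB h'⟩
    refine ⟨h1, ?_⟩
    rw [← hh.map_h]
    exact h1.R₂.linearCombination (hc.invWeightIntegrable ae_ne_zero_Ipos h1) α₂ β₂
  · have h1 : InvWeightIntegrable h' := by
      rw [← hh.map_h, hO]
      exact ⟨B h, hB h⟩
    refine ⟨?_, h1⟩
    rw [← hh.map_h']
    exact h1.R₁.linearCombination (hc.invWeightIntegrable ae_ne_zero_Ineg h1) α₁ β₁

end Boundary

end Stochastic

/-! ### The flux equation on a single characteristic. -/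

section OneDimensional

/-- Integration by parts for a continuously differentiable function and a primitive of an
integrable one. -/
theorem integral_deriv_mul_primitive {g φ φ' : ℝ → ℝ} {b c : ℝ} (j : ℝ)
    (hg : IntervalIntegrable g volume b c) (hφ : ∀ x, HasDerivAt φ (φ' x) x)
    (hφ' : Continuous φ') :
    ∫ x in b..c, φ' x * (j + ∫ y in b..x, g y) =
      φ c * (j + ∫ y in b..c, g y) - φ b * j - ∫ x in b..c, φ x * g x := by
  have hdφ : deriv φ = φ' := funext fun x => (hφ x).deriv
  have hφac : AbsolutelyContinuousOnInterval φ b c := by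
    refine ContDiffOn.absolutelyContinuousOnInterval (ContDiff.contDiffOn ?_)
    exact contDiff_one_iff_deriv.2 ⟨fun x => (hφ x).differentiableAt, by rwa [hdφ]⟩
  have hjac : AbsolutelyContinuousOnInterval (fun _ : ℝ => j) b c :=
    ContDiffOn.absolutelyContinuousOnInterval contDiffOn_const
  have hgac := hjac.fun_add (hg.absolutelyContinuousOnInterval_intervalIntegral left_mem_uIcc)
  have key := hφac.integral_mul_deriv_eq_deriv_mul hgac
  have hd : ∫ x in b..c, φ x * deriv (fun x => j + ∫ y in b..x, g y) x =
      ∫ x in b..c, φ x * g x := by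
    refine intervalIntegral.integral_congr_ae ?_
    filter_upwards [hg.ae_hasDerivAt_integral] with x hx hxm
    rw [((hx (uIoc_subset_uIcc hxm) b left_mem_uIcc).const_add j).deriv]
  rw [hd, hdφ] at key
  rw [key]
  simp

/-- The solution of `F' + κ F = g`, `F b = j`. -/
noncomputable def travel (κ b j : ℝ) (g : ℝ → ℝ) (x : ℝ) : ℝ :=
  Real.exp (-(κ * (x - b))) * (j + ∫ y in b..x, Real.exp (κ * (y - b)) * g y)

theorem continuous_exp_mul_sub (κ b : ℝ) : Continuous fun y : ℝ => Real.exp (κ * (y - b)) := by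
  fun_prop

theorem intervalIntegrable_exp_mul {g : ℝ → ℝ} {b c : ℝ} (κ : ℝ)
    (hg : IntervalIntegrable g volume b c) :
    IntervalIntegrable (fun y => Real.exp (κ * (y - b)) * g y) volume b c :=
  hg.continuousOn_mul (continuous_exp_mul_sub κ b).continuousOn

theorem continuousOn_travel {g : ℝ → ℝ} {b c : ℝ} (κ j : ℝ)
    (hg : IntervalIntegrable g volume b c) : ContinuousOn (travel κ b j g) (uIcc b c) := by
  refine ContinuousOn.mul (by fun_prop) (continuousOn_const.add ?_)
  exact intervalIntegral.continuousOn_primitive_interval' (intervalIntegrable_exp_mul κ hg)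
    left_mem_uIcc

/-- Integrating by parts with `exp (-κ (x - b))` turns Duhamel's formula into the integral form of
the ODE, without assuming `g` continuous. -/
theorem travel_eq {g : ℝ → ℝ} {b c : ℝ} (κ j : ℝ) (hg : IntervalIntegrable g volume b c) :
    travel κ b j g c = j + ∫ y in b..c, (g y - κ * travel κ b j g y) := by
  have hder : ∀ x, HasDerivAt (fun x : ℝ => Real.exp (-(κ * (x - b))))
      (-κ * Real.exp (-(κ * (x - b)))) x := by
    intro x
    have := ((((hasDerivAt_id' x).sub_const b).const_mul κ).fun_neg).exp
    convert this using 1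
    ring
  have key := integral_deriv_mul_primitive j (intervalIntegrable_exp_mul κ hg) hder (by fun_prop)
  have e1 : ∫ x in b..c, Real.exp (-(κ * (x - b))) * (Real.exp (κ * (x - b)) * g x) =
      ∫ x in b..c, g x := by
    congr 1; ext x
    rw [← mul_assoc, ← Real.exp_add]; simp
  have e2 : ∫ x in b..c, -κ * Real.exp (-(κ * (x - b))) *
      (j + ∫ y in b..x, Real.exp (κ * (y - b)) * g y) =
      ∫ x in b..c, -(κ * travel κ b j g x) := by
    congr 1; ext x
    simp only [travel]; ring
  rw [e1, e2] at key
  simp only [sub_self, mul_zero, neg_zero, Real.exp_zero, one_mul,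
    intervalIntegral.integral_neg] at key
  rw [intervalIntegral.integral_sub hg
    ((continuousOn_travel κ j hg).intervalIntegrable.const_mul κ)]
  change _ = travel κ b j g c - j - _ at key
  linarith

/-- Uniqueness for the ODE by the integrating factor `exp (κ (x - b))`; it carries the estimate for
the explicit solution over to arbitrary solutions. -/
theorem travel_of_eq {q Φ : ℝ → ℝ} {b c : ℝ} (κ j : ℝ) (hq : IntervalIntegrable q volume b c)
    (hΦ : ∀ x ∈ uIcc b c, Φ x = j + ∫ y in b..x, q y) :
    Φ c = travel κ b j (fun y => q y + κ * Φ y) c := by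
  have hder : ∀ x, HasDerivAt (fun x : ℝ => Real.exp (κ * (x - b)))
      (κ * Real.exp (κ * (x - b))) x := by
    intro x
    have := (((hasDerivAt_id' x).sub_const b).const_mul κ).exp
    convert this using 1
    ring
  have key := integral_deriv_mul_primitive j hq hder (by fun_prop)
  have hΦc : ContinuousOn Φ (uIcc b c) := ContinuousOn.congr (continuousOn_const.add
    (intervalIntegral.continuousOn_primitive_interval' hq left_mem_uIcc)) hΦ
  have e2 : ∫ x in b..c, κ * Real.exp (κ * (x - b)) * (j + ∫ y in b..x, q y) =
      ∫ x in b..c, Real.exp (κ * (x - b)) * (κ * Φ x) := by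
    refine intervalIntegral.integral_congr fun x hx => ?_
    simp only [hΦ x hx]; ring
  rw [e2, ← hΦ c right_mem_uIcc] at key
  simp only [sub_self, mul_zero, Real.exp_zero, one_mul] at key
  have e3 : ∫ y in b..c, Real.exp (κ * (y - b)) * (q y + κ * Φ y) =
      Real.exp (κ * (c - b)) * Φ c - j := by
    simp only [mul_add]
    rw [intervalIntegral.integral_add (intervalIntegrable_exp_mul κ hq)
      (intervalIntegrable_exp_mul κ (hΦc.intervalIntegrable.const_mul κ)), key]
    ring
  rw [travel, e3, add_sub_cancel, ← mul_assoc, ← Real.exp_add]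
  simp

theorem abs_travel_le {g : ℝ → ℝ} {b x : ℝ} (κ j : ℝ) (hx : b ≤ x) :
    |travel κ b j g x| ≤ travel κ b |j| (fun y => |g y|) x := by
  rw [travel, travel, abs_mul, Real.abs_exp]
  refine mul_le_mul_of_nonneg_left ((abs_add_le _ _).trans (add_le_add_right ?_ _))
    (Real.exp_pos _).le
  refine (intervalIntegral.abs_integral_le_integral_abs hx).trans_eq ?_
  simp only [abs_mul, Real.abs_exp]

/-- For the data `|j|` and `|g|` the integrated ODE is an exact balance of absorption, outflow,
inflow and source. The solution for these data dominates the absolute value of the original one. -/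
theorem integral_abs_travel_le {g : ℝ → ℝ} {b c κ : ℝ} (j : ℝ) (hκ : 0 ≤ κ) (hbc : b ≤ c)
    (hg : IntervalIntegrable g volume b c) :
    κ * (∫ x in b..c, |travel κ b j g x|) + |travel κ b j g c| ≤ |j| + ∫ x in b..c, |g x| := by
  have h1 := travel_eq κ |j| hg.abs
  have hc := (continuousOn_travel κ |j| hg.abs).intervalIntegrable (μ := volume)
  rw [intervalIntegral.integral_sub hg.abs (hc.const_mul κ),
    intervalIntegral.integral_const_mul] at h1
  have h2 := abs_travel_le (g := g) κ j hbc
  have h3 : ∫ x in b..c, |travel κ b j g x| ≤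
      ∫ x in b..c, travel κ b |j| (fun y => |g y|) x :=
    intervalIntegral.integral_mono_on hbc
      ((continuousOn_travel κ j hg).intervalIntegrable (μ := volume)).abs hc
      fun x hx => abs_travel_le κ j hx.1
  have := mul_le_mul_of_nonneg_left h3 hκ
  linarith

/-- `F` solves `F' = q` on `(-a, a)` with boundary values `j` at `-a` and `k` at `a`. -/
def Streams (a : ℝ) (F q : ℝ → ℝ) (j k : ℝ) : Prop :=
  (∀ᵐ x ∂((volume : Measure ℝ).restrict (Ioo (-a) a)), F x = j + ∫ y in (-a)..x, q y) ∧
    k = j + ∫ y in (-a)..a, q y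

theorem intervalIntegrable_iff_restrict_Ioo {a : ℝ} (ha : 0 < a) {f : ℝ → ℝ} :
    IntervalIntegrable f volume (-a) a ↔
      Integrable f ((volume : Measure ℝ).restrict (Ioo (-a) a)) := by
  rw [intervalIntegrable_iff_integrableOn_Ioo_of_le (by linarith)]
  rfl

theorem intervalIntegral_eq_restrict_Ioo {a : ℝ} (ha : 0 < a) (f : ℝ → ℝ) :
    ∫ x in (-a)..a, f x = ∫ x, f x ∂((volume : Measure ℝ).restrict (Ioo (-a) a)) := by
  rw [intervalIntegral.integral_of_le (by linarith), integral_Ioc_eq_integral_Ioo]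

theorem Streams.norm_le {a κ j k : ℝ} {F q : ℝ → ℝ} (ha : 0 < a) (h : Streams a F q j k)
    (hq : Integrable q ((volume : Measure ℝ).restrict (Ioo (-a) a))) (hκ : 0 ≤ κ) :
    κ * (∫ x, |F x| ∂((volume : Measure ℝ).restrict (Ioo (-a) a))) + |k| ≤
      |j| + ∫ x, |q x + κ * F x| ∂((volume : Measure ℝ).restrict (Ioo (-a) a)) := by
  rw [← intervalIntegrable_iff_restrict_Ioo ha] at hq
  -- `Φ` is the continuous representative of `F`, to which the uniqueness statement applies at every
  -- point.
  set Φ : ℝ → ℝ := fun x => j + ∫ y in (-a)..x, q y with hΦ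
  have hle : -a ≤ a := by linarith
  have hΦc : ContinuousOn Φ (uIcc (-a) a) := continuousOn_const.add
    (intervalIntegral.continuousOn_primitive_interval' hq left_mem_uIcc)
  have hsub : ∀ x ∈ Icc (-a) a, uIcc (-a) x ⊆ uIcc (-a) a := fun x hx => by
    rw [uIcc_of_le hx.1, uIcc_of_le hle]
    exact Icc_subset_Icc_right hx.2
  have ht : ∀ x ∈ Icc (-a) a, Φ x = travel κ (-a) j (fun y => q y + κ * Φ y) x := fun x hx =>
    travel_of_eq κ j (hq.mono_set (hsub x hx)) fun y _ => rfl
  have hg : IntervalIntegrable (fun y => q y + κ * Φ y) volume (-a) a :=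
    hq.add (hΦc.intervalIntegrable.const_mul κ)
  have key := integral_abs_travel_le j hκ hle hg
  have e1 : ∫ x in (-a)..a, |travel κ (-a) j (fun y => q y + κ * Φ y) x| =
      ∫ x, |F x| ∂((volume : Measure ℝ).restrict (Ioo (-a) a)) := by
    rw [intervalIntegral_eq_restrict_Ioo ha]
    refine integral_congr_ae ?_
    filter_upwards [h.1, ae_restrict_mem measurableSet_Ioo] with x hx hxm
    rw [← ht x (Ioo_subset_Icc_self hxm), hx]
  have e2 : ∫ x in (-a)..a, |q x + κ * Φ x| =
      ∫ x, |q x + κ * F x| ∂((volume : Measure ℝ).restrict (Ioo (-a) a)) := by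
    rw [intervalIntegral_eq_restrict_Ioo ha]
    refine integral_congr_ae ?_
    filter_upwards [h.1] with x hx
    rw [hx]
  rwa [e1, e2, ← ht a ⟨hle, le_rfl⟩, ← show k = Φ a from h.2] at key

theorem streams_travel {a : ℝ} (ha : 0 < a) (κ j : ℝ) {g : ℝ → ℝ}
    (hg : Integrable g ((volume : Measure ℝ).restrict (Ioo (-a) a))) :
    Streams a (travel κ (-a) j g) (fun y => g y - κ * travel κ (-a) j g y) j
      (travel κ (-a) j g a) := by
  rw [← intervalIntegrable_iff_restrict_Ioo ha] at hg
  refine ⟨?_, travel_eq κ j hg⟩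
  filter_upwards [ae_restrict_mem measurableSet_Ioo] with x hx
  refine travel_eq κ j (hg.mono_set ?_)
  rw [uIcc_of_le hx.1.le, uIcc_of_le (by linarith)]
  exact Icc_subset_Icc_right hx.2.le

end OneDimensional

/-! ### Orienting characteristics so that every particle enters at `-a` and leaves at `a`. -/

/-- The direction of motion of a particle with velocity `v ≠ 0`. -/
noncomputable def dir (v : ℝ) : ℝ := if 0 < v then 1 else -1

theorem dir_of_pos {v : ℝ} (hv : 0 < v) : dir v = 1 := if_pos hv

theorem dir_of_neg {v : ℝ} (hv : v < 0) : dir v = -1 := if_neg hv.not_gt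

theorem measurable_dir : Measurable dir :=
  Measurable.ite measurableSet_Ioi measurable_const measurable_const

theorem measurePreserving_neg_Ioo (a : ℝ) : MeasurePreserving (fun x : ℝ => -x)
    ((volume : Measure ℝ).restrict (Ioo (-a) a)) ((volume : Measure ℝ).restrict (Ioo (-a) a)) := by
  have h := (Measure.measurePreserving_neg (volume : Measure ℝ)).restrict_preimage
    (s := Ioo (-a) a) measurableSet_Ioo
  have e : (Neg.neg : ℝ → ℝ) ⁻¹' Ioo (-a) a = Ioo (-a) a := by
    ext v; simp [and_comm]
  rw [e] at h
  exact h

theorem measurePreserving_dir_mul (a v : ℝ) : MeasurePreserving (fun x : ℝ => dir v * x)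
    ((volume : Measure ℝ).restrict (Ioo (-a) a)) ((volume : Measure ℝ).restrict (Ioo (-a) a)) := by
  by_cases hv : 0 < v
  · simpa only [dir_of_pos hv, one_mul] using! MeasurePreserving.id _
  · simpa only [dir, if_neg hv, neg_mul, one_mul] using measurePreserving_neg_Ioo a

theorem intervalIntegrable_of_mem_Icc {a x y : ℝ} {W : ℝ → ℝ}
    (hW : IntervalIntegrable W volume (-a) a) (hx : x ∈ Icc (-a) a) (hy : y ∈ Icc (-a) a) :
    IntervalIntegrable W volume x y :=
  hW.mono_set (uIcc_subset_uIcc (Icc_subset_uIcc hx) (Icc_subset_uIcc hy))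

/-- In terms of the traces `U` and `U'` at `-a` and `a`, a solution in the direction of motion is a
function that is represented from both ends. -/
theorem streams_iff_traces {a v U U' : ℝ} {F W : ℝ → ℝ} (ha : 0 < a) (hv : v ≠ 0)
    (hW : Integrable W ((volume : Measure ℝ).restrict (Ioo (-a) a))) :
    Streams a (fun x => |v| * F (dir v * x)) (fun y => W (dir v * y))
        (|v| * if 0 < v then U else U') (|v| * if 0 < v then U' else U) ↔
      (∀ᵐ x ∂((volume : Measure ℝ).restrict (Ioo (-a) a)),
        v * F x = v * U + ∫ y in (-a)..x, W y) ∧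
      (∀ᵐ x ∂((volume : Measure ℝ).restrict (Ioo (-a) a)),
        v * F x = v * U' + ∫ y in a..x, W y) := by
  have hle : -a ≤ a := by linarith
  have hW' := (intervalIntegrable_iff_restrict_Ioo ha).2 hW
  have hadd : ∀ x ∈ Ioo (-a) a,
      (∫ y in (-a)..x, W y) - (∫ y in a..x, W y) = ∫ y in (-a)..a, W y := fun x hx =>
    intervalIntegral.integral_interval_sub_interval_comm'
      (intervalIntegrable_of_mem_Icc hW' ⟨le_rfl, hle⟩ (Ioo_subset_Icc_self hx))
      (intervalIntegrable_of_mem_Icc hW' ⟨hle, le_rfl⟩ (Ioo_subset_Icc_self hx))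
      (intervalIntegrable_of_mem_Icc hW' ⟨le_rfl, hle⟩ ⟨hle, le_rfl⟩) |>.trans
        (by simp [intervalIntegral.integral_symm (-a) a])
  have hrel : (∀ᵐ x ∂((volume : Measure ℝ).restrict (Ioo (-a) a)),
        v * F x = v * U + ∫ y in (-a)..x, W y) →
      (∀ᵐ x ∂((volume : Measure ℝ).restrict (Ioo (-a) a)),
        v * F x = v * U' + ∫ y in a..x, W y) → v * U' = v * U + ∫ y in (-a)..a, W y := by
    intro h1 h2
    have : NeBot (ae ((volume : Measure ℝ).restrict (Ioo (-a) a))) := by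
      rw [ae_neBot, ne_eq, Measure.restrict_eq_zero, Real.volume_Ioo]
      simp [ha]
    -- A single point where both representations hold already determines the jump between the two
    -- traces.
    obtain ⟨x, hx1, hx2, hx⟩ := (h1.and (h2.and (ae_restrict_mem measurableSet_Ioo))).exists
    have := hadd x hx
    linarith
  rcases lt_or_gt_of_ne hv with hv | hv
  · have hn : ¬ 0 < v := hv.not_gt
    simp only [Streams, dir_of_neg hv, if_neg hn, abs_of_neg hv, neg_mul, one_mul]
    have hneg : ∀ x, ∫ y in (-a)..x, W (-y) = -∫ y in a..(-x), W y := fun x => by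
      rw [intervalIntegral.integral_comp_neg, neg_neg, intervalIntegral.integral_symm]
    simp only [hneg]
    constructor
    · rintro ⟨h1, h2⟩
      have h1' := (measurePreserving_neg_Ioo a).quasiMeasurePreserving.ae h1
      have hs := intervalIntegral.integral_symm (-a) a (f := W) (μ := volume)
      constructor
      · filter_upwards [h1', ae_restrict_mem measurableSet_Ioo] with x hx hxm
        have := hadd x hxm
        simp only [neg_neg] at hx
        linarith
      · filter_upwards [h1'] with x hx
        simp only [neg_neg] at hx
        linarith
    · rintro ⟨h1, h2⟩
      have h3 := hrel h1 h2
      have hs := intervalIntegral.integral_symm (-a) a (f := W) (μ := volume)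
      refine ⟨?_, by linarith⟩
      filter_upwards [(measurePreserving_neg_Ioo a).quasiMeasurePreserving.ae h2] with x hx
      linarith
  · simp only [Streams, dir_of_pos hv, if_pos hv, abs_of_pos hv, one_mul]
    constructor
    · rintro ⟨h1, h2⟩
      refine ⟨h1, ?_⟩
      filter_upwards [h1, ae_restrict_mem measurableSet_Ioo] with x hx hxm
      have := hadd x hxm
      linarith
    · rintro ⟨h1, h2⟩
      exact ⟨h1, hrel h1 h2⟩

/-! ### Slicing phase space by velocity and rewriting the domain in terms of fluxes. -/

section PhaseSpace

variable {a : ℝ}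

theorem ae_ae_of_ae_phaseMeasure {P : ℝ × ℝ → Prop} (h : ∀ᵐ p ∂(phaseMeasure a), P p) :
    ∀ᵐ v ∂((volume : Measure ℝ).restrict (Ioo (-1) 1)),
      ∀ᵐ x ∂((volume : Measure ℝ).restrict (Ioo (-a) a)), P (x, v) :=
  Measure.ae_ae_of_ae_prod (Measure.measurePreserving_swap.quasiMeasurePreserving.ae h)

theorem ae_phaseMeasure_of_ae_ae {P : ℝ × ℝ → Prop} (hP : MeasurableSet {p | P p})
    (h : ∀ᵐ v ∂((volume : Measure ℝ).restrict (Ioo (-1) 1)),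
      ∀ᵐ x ∂((volume : Measure ℝ).restrict (Ioo (-a) a)), P (x, v)) :
    ∀ᵐ p ∂(phaseMeasure a), P p := by
  have h1 := (Measure.ae_prod_iff_ae_ae (p := fun q : ℝ × ℝ => P q.swap)
    (measurable_swap hP)).2 h
  exact Measure.measurePreserving_swap.quasiMeasurePreserving.ae h1

theorem ae_phaseMeasure_of_ae_velocity {P : ℝ → Prop}
    (h : ∀ᵐ v ∂((volume : Measure ℝ).restrict (Ioo (-1) 1)), P v) :
    ∀ᵐ p ∂(phaseMeasure a), P p.2 :=
  Measure.quasiMeasurePreserving_snd.ae h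

theorem ae_integrable_section {f : ℝ × ℝ → ℝ} (hf : Integrable f (phaseMeasure a)) :
    ∀ᵐ v ∂((volume : Measure ℝ).restrict (Ioo (-1) 1)),
      Integrable (fun x => f (x, v)) ((volume : Measure ℝ).restrict (Ioo (-a) a)) :=
  hf.prod_left_ae

theorem ae_velocity_ne_zero : ∀ᵐ v ∂((volume : Measure ℝ).restrict (Ioo (-1) 1)), v ≠ 0 :=
  Measure.ae_ne _ 0

/-- The oriented integral is a difference of two parametric integrals of indicators of measurable
sets, each covered by Fubini measurability. Joint measurability is needed to pass from almost every
slice back to phase space. -/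
theorem measurable_primitive {w : ℝ × ℝ → ℝ} (hw : Measurable w) (c : ℝ) :
    Measurable fun p : ℝ × ℝ => ∫ y in c..p.1, w (y, p.2) := by
  have hm : Measurable fun z : (ℝ × ℝ) × ℝ => w (z.2, z.1.2) := by fun_prop
  have key : ∀ s : Set ((ℝ × ℝ) × ℝ), MeasurableSet s →
      Measurable fun p : ℝ × ℝ => ∫ y, s.indicator (fun z => w (z.2, z.1.2)) (p, y) := fun s hs =>
    ((hm.indicator hs).stronglyMeasurable.integral_prod_right' (ν := volume)).measurable
  have h1 := key {z | c < z.2 ∧ z.2 ≤ z.1.1}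
    ((measurableSet_lt measurable_const measurable_snd).inter
      (measurableSet_le measurable_snd measurable_fst.fst))
  have h2 := key {z | z.1.1 < z.2 ∧ z.2 ≤ c}
    ((measurableSet_lt measurable_fst.fst measurable_snd).inter
      (measurableSet_le measurable_snd measurable_const))
  convert h1.sub h2 using 1
  ext p
  rw [intervalIntegral, ← integral_indicator measurableSet_Ioc,
    ← integral_indicator measurableSet_Ioc]
  rfl

/-- A function with a trace is differentiable in the sense of distributions. -/
theorem IsTrace.hasWeakStreaming (ha : 0 < a) {f w : L1Phase a} {u : ℝ → ℝ}
    (h : IsTrace a (-a) f w u) : HasWeakStreaming a f w := by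
  intro φ hφ hφc hφs
  have hφ1 : Continuous fun p : ℝ × ℝ => fderiv ℝ φ p (1, 0) :=
    (hφ.continuous_fderiv (by simp)).clm_apply continuous_const
  have hfi := L1.integrable_coeFn f
  have hwi := L1.integrable_coeFn w
  have hb1 : HasCompactSupport fun p : ℝ × ℝ => p.2 * fderiv ℝ φ p (1, 0) := by
    refine HasCompactSupport.mul_left ?_
    exact (hφc.fderiv (𝕜 := ℝ)).comp_left (g := fun L : (ℝ × ℝ) →L[ℝ] ℝ => L (1, 0)) rfl
  obtain ⟨C1, hC1⟩ := hb1.exists_bound_of_continuous (continuous_snd.mul hφ1)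
  obtain ⟨C2, hC2⟩ := hφc.exists_bound_of_continuous hφ.continuous
  have hi1 : Integrable (fun p => f p * (p.2 * fderiv ℝ φ p (1, 0))) (phaseMeasure a) :=
    hfi.mul_bdd (c := C1) (continuous_snd.mul hφ1).aestronglyMeasurable
      (Eventually.of_forall hC1)
  have hi2 : Integrable (fun p => w p * φ p) (phaseMeasure a) :=
    hwi.mul_bdd (c := C2) hφ.continuous.aestronglyMeasurable (Eventually.of_forall hC2)
  rw [integral_prod_symm _ hi1, integral_prod_symm _ hi2, ← integral_neg]
  refine integral_congr_ae ?_
  filter_upwards [ae_ae_of_ae_phaseMeasure h, ae_integrable_section hwi] with v hv hwv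
  have hder : ∀ x, HasDerivAt (fun x : ℝ => φ (x, v)) (fderiv ℝ φ (x, v) (1, 0)) x := by
    intro x
    have h1 := (hφ.differentiable (by simp) (x, v)).hasFDerivAt
    have h2 : HasDerivAt (fun x : ℝ => (x, v)) (1, 0) x :=
      (hasDerivAt_id x).prodMk (hasDerivAt_const x v)
    exact h1.comp_hasDerivAt x h2
  have key := integral_deriv_mul_primitive (v * u v)
    ((intervalIntegrable_iff_restrict_Ioo ha).2 hwv) hder
    (hφ1.comp (continuous_id.prodMk continuous_const))
  have hz : ∀ c, c ∉ Ioo (-a) a → φ (c, v) = 0 := fun c hc =>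
    image_eq_zero_of_notMem_tsupport fun hm => hc (hφs hm).1
  rw [hz a (by simp), hz (-a) (by simp), zero_mul, zero_mul, sub_zero, zero_sub,
    intervalIntegral_eq_restrict_Ioo ha, intervalIntegral_eq_restrict_Ioo ha] at key
  simp only [mul_comm (w _)]
  rw [← key]
  refine integral_congr_ae ?_
  filter_upwards [hv] with x hx
  rw [← hx]
  ring

/-- The function on `(-1, 1)` with the given restrictions to `(0, 1)` and `(-1, 0)`. -/
noncomputable def glue (p : L1 Ipos) (n : L1 Ineg) (v : ℝ) : ℝ := if 0 < v then p v else n v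

theorem measurable_glue (p : L1 Ipos) (n : L1 Ineg) : Measurable (glue p n) :=
  Measurable.ite measurableSet_Ioi (Lp.stronglyMeasurable p).measurable
    (Lp.stronglyMeasurable n).measurable

theorem velocityMeasure_eq : (volume : Measure ℝ).restrict (Ioo (-1) 1) =
    (volume : Measure ℝ).restrict Ipos + (volume : Measure ℝ).restrict Ineg := by
  rw [← Measure.restrict_union _ measurableSet_Ioo]
  · refine Measure.restrict_congr_set ?_
    filter_upwards [Measure.ae_ne volume (0 : ℝ)] with v hv
    refine propext ⟨fun h => ?_, fun h => ?_⟩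
    · rcases lt_or_gt_of_ne hv with h0 | h0
      · exact Or.inr ⟨h.1, h0⟩
      · exact Or.inl ⟨h0, h.2⟩
    · rcases h with h | h
      · exact ⟨by linarith [h.1], h.2⟩
      · exact ⟨h.1, by linarith [h.2]⟩
  · exact disjoint_left.2 fun v h1 h2 => lt_asymm h1.1 h2.2

theorem ae_velocity_iff {P : ℝ → Prop} :
    (∀ᵐ v ∂((volume : Measure ℝ).restrict (Ioo (-1) 1)), P v) ↔
      (∀ᵐ v ∂((volume : Measure ℝ).restrict Ipos), P v) ∧
        ∀ᵐ v ∂((volume : Measure ℝ).restrict Ineg), P v := by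
  rw [velocityMeasure_eq, ae_add_measure_iff]

/-- The functions whose restrictions to almost all characteristics are absolutely continuous with
derivative given by `w`, with incoming flux `j` and outgoing flux `k`. -/
def StreamsOnPhase (a : ℝ) (f w : ℝ × ℝ → ℝ) (j k : ℝ → ℝ) : Prop :=
  ∀ᵐ v ∂((volume : Measure ℝ).restrict (Ioo (-1) 1)),
    Streams a (fun x => |v| * f (dir v * x, v)) (fun y => w (dir v * y, v)) (j v) (k v)

/-- Only the two outgoing fluxes are free data: the boundary conditions give the incoming ones. In
the converse direction the traces are the fluxes divided by `|v|`, and the distributional equation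
follows from the representation by the trace at `-a`. -/
theorem mem_transportGraph_iff (ha : 0 < a) {P₁ : L1 Ineg →L[ℝ] L1 Ipos}
    {P₂ : L1 Ipos →L[ℝ] L1 Ineg} {q : L1Phase a × L1Phase a} :
    q ∈ transportGraph a P₁ P₂ ↔ ∃ (hlneg : L1 Ineg) (hrpos : L1 Ipos),
      StreamsOnPhase a q.1 (-q.2 : L1Phase a) (glue (P₁ hlneg) (P₂ hrpos)) (glue hrpos hlneg) := by
  have hwi := ae_integrable_section (L1.integrable_coeFn (-q.2))
  constructor
  · rintro ⟨-, u, u', hlneg, hrneg, hlpos, hrpos, hu, hu', h1, h2, h3, h4, rfl, rfl⟩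
    refine ⟨hlneg, hrpos, ?_⟩
    have hin : ∀ᵐ v ∂((volume : Measure ℝ).restrict (Ioo (-1) 1)),
        glue (P₁ hlneg) (P₂ hrpos) v = |v| * (if 0 < v then u v else u' v) ∧
        glue hrpos hlneg v = |v| * (if 0 < v then u' v else u v) := by
      refine ae_velocity_iff.2 ⟨?_, ?_⟩
      · filter_upwards [h2, h4, ae_restrict_mem measurableSet_Ioo] with v h2 h4 hv
        simp only [glue, if_pos hv.1, h2, h4, and_self]
      · filter_upwards [h1, h3, ae_restrict_mem measurableSet_Ioo] with v h1 h3 hv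
        simp only [glue, if_neg hv.2.not_gt, h1, h3, and_self]
    filter_upwards [hin, hwi, ae_velocity_ne_zero, ae_ae_of_ae_phaseMeasure hu,
      ae_ae_of_ae_phaseMeasure hu'] with v hv hwv hv0 huv huv'
    rw [hv.1, hv.2]
    exact (streams_iff_traces ha hv0 hwv).2 ⟨huv, huv'⟩
  · rintro ⟨hlneg, hrpos, h⟩
    set u : ℝ → ℝ := fun v => |v|⁻¹ * glue (P₁ hlneg) hlneg v with hu
    set u' : ℝ → ℝ := fun v => |v|⁻¹ * glue hrpos (P₂ hrpos) v with hu'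
    have hmeas : ∀ (c : ℝ) (U : ℝ → ℝ), Measurable U → MeasurableSet {p : ℝ × ℝ |
        p.2 * q.1 p = p.2 * U p.2 + ∫ y in c..p.1, (-q.2 : L1Phase a) (y, p.2)} := by
      intro c U hU
      refine measurableSet_eq_fun
        (measurable_snd.mul (Lp.stronglyMeasurable q.1).measurable) ?_
      exact (measurable_snd.mul (hU.comp measurable_snd)).add
        (measurable_primitive (Lp.stronglyMeasurable (-q.2)).measurable c)
    have hmu : Measurable u := measurable_abs.inv.mul (measurable_glue _ _)
    have hmu' : Measurable u' := measurable_abs.inv.mul (measurable_glue _ _)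
    have key : ∀ᵐ v ∂((volume : Measure ℝ).restrict (Ioo (-1) 1)),
        (∀ᵐ x ∂((volume : Measure ℝ).restrict (Ioo (-a) a)),
          v * q.1 (x, v) = v * u v + ∫ y in (-a)..x, (-q.2 : L1Phase a) (y, v)) ∧
        (∀ᵐ x ∂((volume : Measure ℝ).restrict (Ioo (-a) a)),
          v * q.1 (x, v) = v * u' v + ∫ y in a..x, (-q.2 : L1Phase a) (y, v)) := by
      filter_upwards [h, hwi, ae_velocity_ne_zero] with v hv hwv hv0
      refine (streams_iff_traces ha hv0 hwv).1 ?_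
      convert hv using 1
      · by_cases h0 : 0 < v <;> simp [hu, hu', glue, h0, hv0]
      · by_cases h0 : 0 < v <;> simp [hu, hu', glue, h0, hv0]
    have ht : IsTrace a (-a) q.1 (-q.2) u :=
      ae_phaseMeasure_of_ae_ae (hmeas _ _ hmu) (key.mono fun v hv => hv.1)
    refine ⟨ht.hasWeakStreaming ha, u, u', hlneg, P₂ hrpos, P₁ hlneg, hrpos, ht,
      ae_phaseMeasure_of_ae_ae (hmeas _ _ hmu') (key.mono fun v hv => hv.2), ?_, ?_, ?_, ?_,
      rfl, rfl⟩
    · filter_upwards [ae_restrict_mem measurableSet_Ioo] with v hv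
      simp [hu, glue, hv.2.not_gt, hv.2.ne]
    · filter_upwards [ae_restrict_mem measurableSet_Ioo] with v hv
      simp [hu, glue, hv.1, hv.1.ne']
    · filter_upwards [ae_restrict_mem measurableSet_Ioo] with v hv
      simp [hu', glue, hv.2.not_gt, hv.2.ne]
    · filter_upwards [ae_restrict_mem measurableSet_Ioo] with v hv
      simp [hu', glue, hv.1, hv.1.ne']

end PhaseSpace

/-! ### Linearity of the flux equation, the energy estimate and dissipativity. -/

section StreamsAlgebra

variable {a : ℝ}

theorem integral_primitive_congr {q q' : ℝ → ℝ} {x : ℝ} (hx : x ∈ Icc (-a) a)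
    (hq : q =ᵐ[(volume : Measure ℝ).restrict (Ioo (-a) a)] q') :
    ∫ y in (-a)..x, q y = ∫ y in (-a)..x, q' y := by
  rw [intervalIntegral.integral_of_le hx.1, intervalIntegral.integral_of_le hx.1,
    integral_Ioc_eq_integral_Ioo, integral_Ioc_eq_integral_Ioo]
  exact integral_congr_ae (ae_mono (Measure.restrict_mono (Ioo_subset_Ioo_right hx.2) le_rfl) hq)

theorem Streams.congr {F F' q q' : ℝ → ℝ} {j k : ℝ} (ha : 0 < a) (h : Streams a F q j k)
    (hF : F =ᵐ[(volume : Measure ℝ).restrict (Ioo (-a) a)] F')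
    (hq : q =ᵐ[(volume : Measure ℝ).restrict (Ioo (-a) a)] q') : Streams a F' q' j k := by
  refine ⟨?_, ?_⟩
  · filter_upwards [h.1, hF, ae_restrict_mem measurableSet_Ioo] with x h1 h2 hx
    rw [← h2, h1, integral_primitive_congr (Ioo_subset_Icc_self hx) hq]
  · rw [h.2, integral_primitive_congr ⟨by linarith, le_rfl⟩ hq]

theorem Streams.add {F F' q q' : ℝ → ℝ} {j j' k k' : ℝ} (ha : 0 < a) (h : Streams a F q j k)
    (h' : Streams a F' q' j' k')
    (hq : Integrable q ((volume : Measure ℝ).restrict (Ioo (-a) a)))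
    (hq' : Integrable q' ((volume : Measure ℝ).restrict (Ioo (-a) a))) :
    Streams a (fun x => F x + F' x) (fun x => q x + q' x) (j + j') (k + k') := by
  rw [← intervalIntegrable_iff_restrict_Ioo ha] at hq hq'
  have hl : -a ∈ Icc (-a) a := ⟨le_rfl, by linarith⟩
  have hr : a ∈ Icc (-a) a := ⟨by linarith, le_rfl⟩
  refine ⟨?_, ?_⟩
  · filter_upwards [h.1, h'.1, ae_restrict_mem measurableSet_Ioo] with x h1 h2 hx
    have hx' := Ioo_subset_Icc_self hx
    rw [h1, h2, intervalIntegral.integral_add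
      (intervalIntegrable_of_mem_Icc hq hl hx')
      (intervalIntegrable_of_mem_Icc hq' hl hx')]
    ring
  · rw [h.2, h'.2, intervalIntegral.integral_add hq hq']
    ring

theorem Streams.const_mul {F q : ℝ → ℝ} {j k : ℝ} (h : Streams a F q j k) (c : ℝ) :
    Streams a (fun x => c * F x) (fun x => c * q x) (c * j) (c * k) := by
  refine ⟨?_, ?_⟩
  · filter_upwards [h.1] with x h1
    rw [h1, intervalIntegral.integral_const_mul, mul_add]
  · rw [h.2, intervalIntegral.integral_const_mul, mul_add]

theorem ae_section_eq {f f' : ℝ × ℝ → ℝ} (h : f =ᵐ[phaseMeasure a] f') :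
    ∀ᵐ v ∂((volume : Measure ℝ).restrict (Ioo (-1) 1)),
      (fun x => f (dir v * x, v)) =ᵐ[(volume : Measure ℝ).restrict (Ioo (-a) a)]
        fun x => f' (dir v * x, v) := by
  filter_upwards [ae_ae_of_ae_phaseMeasure h] with v hv
  exact (measurePreserving_dir_mul a v).quasiMeasurePreserving.ae hv

theorem ae_integrable_section_dir {f : ℝ × ℝ → ℝ} (hf : Integrable f (phaseMeasure a)) :
    ∀ᵐ v ∂((volume : Measure ℝ).restrict (Ioo (-1) 1)),
      Integrable (fun x => f (dir v * x, v)) ((volume : Measure ℝ).restrict (Ioo (-a) a)) := by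
  filter_upwards [ae_integrable_section hf] with v hv
  exact (measurePreserving_dir_mul a v).integrable_comp_of_integrable hv

theorem integral_section_dir (f : ℝ × ℝ → ℝ) (v : ℝ) :
    ∫ x, f (dir v * x, v) ∂((volume : Measure ℝ).restrict (Ioo (-a) a)) =
      ∫ x, f (x, v) ∂((volume : Measure ℝ).restrict (Ioo (-a) a)) := by
  by_cases hv : 0 < v
  · simp only [dir_of_pos hv, one_mul]
  · simp only [dir, if_neg hv, neg_mul, one_mul]
    exact (measurePreserving_neg_Ioo a).integral_comp (Homeomorph.neg ℝ).measurableEmbedding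
      (fun x => f (x, v))

theorem StreamsOnPhase.congr {f f' w w' : ℝ × ℝ → ℝ} {j j' k k' : ℝ → ℝ} (ha : 0 < a)
    (h : StreamsOnPhase a f w j k) (hf : f =ᵐ[phaseMeasure a] f')
    (hw : w =ᵐ[phaseMeasure a] w')
    (hj : j =ᵐ[(volume : Measure ℝ).restrict (Ioo (-1) 1)] j')
    (hk : k =ᵐ[(volume : Measure ℝ).restrict (Ioo (-1) 1)] k') :
    StreamsOnPhase a f' w' j' k' := by
  filter_upwards [h, ae_section_eq hf, ae_section_eq hw, hj, hk] with v h1 h2 h3 h4 h5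
  rw [← h4, ← h5]
  refine h1.congr ha ?_ h3
  filter_upwards [h2] with x hx
  rw [hx]

theorem StreamsOnPhase.add {f f' w w' : ℝ × ℝ → ℝ} {j j' k k' : ℝ → ℝ} (ha : 0 < a)
    (h : StreamsOnPhase a f w j k) (h' : StreamsOnPhase a f' w' j' k')
    (hw : Integrable w (phaseMeasure a)) (hw' : Integrable w' (phaseMeasure a)) :
    StreamsOnPhase a (fun p => f p + f' p) (fun p => w p + w' p) (fun v => j v + j' v)
      (fun v => k v + k' v) := by
  filter_upwards [h, h', ae_integrable_section_dir hw, ae_integrable_section_dir hw']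
    with v h1 h2 h3 h4
  simp only [mul_add]
  exact h1.add ha h2 h3 h4

theorem StreamsOnPhase.const_mul {f w : ℝ × ℝ → ℝ} {j k : ℝ → ℝ}
    (h : StreamsOnPhase a f w j k) (c : ℝ) :
    StreamsOnPhase a (fun p => c * f p) (fun p => c * w p) (fun v => c * j v)
      (fun v => c * k v) := by
  filter_upwards [h] with v h1
  simp only [mul_left_comm _ c]
  exact h1.const_mul c

/-- The energy estimate. -/
theorem StreamsOnPhase.integral_le {f w : ℝ × ℝ → ℝ} {j k : ℝ → ℝ} {l : ℝ} (ha : 0 < a)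
    (hl : 0 < l) (h : StreamsOnPhase a f w j k) (hf : Integrable f (phaseMeasure a))
    (hw : Integrable w (phaseMeasure a))
    (hj : Integrable j ((volume : Measure ℝ).restrict (Ioo (-1) 1)))
    (hk : Integrable k ((volume : Measure ℝ).restrict (Ioo (-1) 1))) :
    l * (∫ p, |f p| ∂(phaseMeasure a)) +
        ∫ v, |k v| ∂((volume : Measure ℝ).restrict (Ioo (-1) 1)) ≤
      (∫ v, |j v| ∂((volume : Measure ℝ).restrict (Ioo (-1) 1))) +
        ∫ p, |l * f p + w p| ∂(phaseMeasure a) := by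
  have hg : Integrable (fun p => l * f p + w p) (phaseMeasure a) := (hf.const_mul l).add hw
  rw [integral_prod_symm _ hf.abs, integral_prod_symm _ hg.abs, ← integral_const_mul,
    ← integral_add (hf.abs.integral_prod_right.const_mul l) hk.abs,
    ← integral_add hj.abs hg.abs.integral_prod_right]
  refine integral_mono_ae ((hf.abs.integral_prod_right.const_mul l).add hk.abs)
    (hj.abs.add hg.abs.integral_prod_right) ?_
  filter_upwards [h, ae_integrable_section_dir hw, ae_velocity_ne_zero] with v h1 h2 h3
  have hv : 0 < |v| := abs_pos.2 h3
  -- The one-dimensional unknown is `|v| f`, so absorption `l` of `f` becomes the rate `l / |v|`,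
  -- and the factors of `|v|` cancel.
  have key := h1.norm_le ha h2 (κ := l / |v|) (by positivity)
  have e1 : l / |v| * ∫ x, |(|v| * f (dir v * x, v))|
      ∂((volume : Measure ℝ).restrict (Ioo (-a) a)) =
      l * ∫ x, |f (x, v)| ∂((volume : Measure ℝ).restrict (Ioo (-a) a)) := by
    simp only [abs_mul, abs_abs, integral_const_mul]
    rw [integral_section_dir (fun p => |f p|) v]
    field_simp
  have e2 : ∫ x, |w (dir v * x, v) + l / |v| * (|v| * f (dir v * x, v))|
      ∂((volume : Measure ℝ).restrict (Ioo (-a) a)) =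
      ∫ x, |l * f (x, v) + w (x, v)| ∂((volume : Measure ℝ).restrict (Ioo (-a) a)) := by
    rw [← integral_section_dir (fun p => |l * f p + w p|) v]
    congr 1; ext x
    rw [← mul_assoc, div_mul_cancel₀ _ hv.ne', add_comm]
  rw [e1, e2] at key
  exact key

theorem glue_ae_eq_pos (p : L1 Ipos) (n : L1 Ineg) :
    glue p n =ᵐ[(volume : Measure ℝ).restrict Ipos] p := by
  filter_upwards [ae_restrict_mem measurableSet_Ioo] with v hv using if_pos hv.1

theorem glue_ae_eq_neg (p : L1 Ipos) (n : L1 Ineg) :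
    glue p n =ᵐ[(volume : Measure ℝ).restrict Ineg] n := by
  filter_upwards [ae_restrict_mem measurableSet_Ioo] with v hv using if_neg hv.2.not_gt

theorem integrable_glue (p : L1 Ipos) (n : L1 Ineg) :
    Integrable (glue p n) ((volume : Measure ℝ).restrict (Ioo (-1) 1)) := by
  rw [velocityMeasure_eq]
  exact ((L1.integrable_coeFn p).congr (glue_ae_eq_pos p n).symm).add_measure
    ((L1.integrable_coeFn n).congr (glue_ae_eq_neg p n).symm)

theorem integral_abs_glue (p : L1 Ipos) (n : L1 Ineg) :
    ∫ v, |glue p n v| ∂((volume : Measure ℝ).restrict (Ioo (-1) 1)) = ‖p‖ + ‖n‖ := by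
  have h := (integrable_glue p n).abs
  rw [velocityMeasure_eq, integrable_add_measure] at h
  rw [velocityMeasure_eq, integral_add_measure h.1 h.2, L1.norm_eq_integral_norm,
    L1.norm_eq_integral_norm]
  congr 1
  · exact integral_congr_ae ((glue_ae_eq_pos p n).fun_comp abs)
  · exact integral_congr_ae ((glue_ae_eq_neg p n).fun_comp abs)

theorem glue_add (p p' : L1 Ipos) (n n' : L1 Ineg) :
    glue (p + p') (n + n') =ᵐ[(volume : Measure ℝ).restrict (Ioo (-1) 1)]
      fun v => glue p n v + glue p' n' v := by
  refine ae_velocity_iff.2 ⟨?_, ?_⟩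
  · filter_upwards [glue_ae_eq_pos (p + p') (n + n'), glue_ae_eq_pos p n, glue_ae_eq_pos p' n',
      Lp.coeFn_add p p'] with v h1 h2 h3 h4
    rw [h1, h2, h3, h4, Pi.add_apply]
  · filter_upwards [glue_ae_eq_neg (p + p') (n + n'), glue_ae_eq_neg p n, glue_ae_eq_neg p' n',
      Lp.coeFn_add n n'] with v h1 h2 h3 h4
    rw [h1, h2, h3, h4, Pi.add_apply]

theorem glue_smul (c : ℝ) (p : L1 Ipos) (n : L1 Ineg) :
    glue (c • p) (c • n) =ᵐ[(volume : Measure ℝ).restrict (Ioo (-1) 1)]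
      fun v => c * glue p n v := by
  refine ae_velocity_iff.2 ⟨?_, ?_⟩
  · filter_upwards [glue_ae_eq_pos (c • p) (c • n), glue_ae_eq_pos p n,
      Lp.coeFn_smul c p] with v h1 h2 h3
    rw [h1, h2, h3, Pi.smul_apply, smul_eq_mul]
  · filter_upwards [glue_ae_eq_neg (c • p) (c • n), glue_ae_eq_neg p n,
      Lp.coeFn_smul c n] with v h1 h2 h3
    rw [h1, h2, h3, Pi.smul_apply, smul_eq_mul]

theorem glue_zero : glue 0 0 =ᵐ[(volume : Measure ℝ).restrict (Ioo (-1) 1)] fun _ => 0 := by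
  simpa using glue_smul 0 0 0

/-- The graph of the transport operator as a linear relation. -/
noncomputable def transportSubmodule (ha : 0 < a) (P₁ : L1 Ineg →L[ℝ] L1 Ipos)
    (P₂ : L1 Ipos →L[ℝ] L1 Ineg) : Submodule ℝ (L1Phase a × L1Phase a) where
  carrier := transportGraph a P₁ P₂
  zero_mem' := by
    refine (mem_transportGraph_iff ha).2 ⟨0, 0, ?_⟩
    have h0 : StreamsOnPhase a (fun _ => 0) (fun _ => 0) (fun _ => 0) (fun _ => 0) := by
      refine Eventually.of_forall fun v => ⟨?_, ?_⟩ <;> simp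
    refine h0.congr ha (Lp.coeFn_zero _ _ _).symm ?_ ?_ glue_zero.symm
    · rw [Prod.snd_zero, neg_zero]
      exact (Lp.coeFn_zero _ _ _).symm
    · simpa using glue_zero.symm
  add_mem' := by
    intro q q' hq hq'
    obtain ⟨n, p, h⟩ := (mem_transportGraph_iff ha).1 hq
    obtain ⟨n', p', h'⟩ := (mem_transportGraph_iff ha).1 hq'
    refine (mem_transportGraph_iff ha).2 ⟨n + n', p + p', ?_⟩
    refine (h.add ha h' (L1.integrable_coeFn _) (L1.integrable_coeFn _)).congr ha
      (Lp.coeFn_add _ _).symm ?_ ?_ (glue_add _ _ _ _).symm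
    · rw [Prod.snd_add, neg_add]
      exact (Lp.coeFn_add _ _).symm
    · rw [map_add, map_add]
      exact (glue_add _ _ _ _).symm
  smul_mem' := by
    intro c q hq
    obtain ⟨n, p, h⟩ := (mem_transportGraph_iff ha).1 hq
    refine (mem_transportGraph_iff ha).2 ⟨c • n, c • p, ?_⟩
    refine (h.const_mul c).congr ha (Lp.coeFn_smul c q.1).symm ?_ ?_ (glue_smul _ _ _).symm
    · rw [Prod.smul_snd, ← smul_neg]
      exact (Lp.coeFn_smul c (-q.2)).symm
    · rw [map_smul, map_smul]
      exact (glue_smul _ _ _).symm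

/-- In the energy estimate the incoming flux is at most the outgoing one, because the boundary
operators are contractions, so the boundary terms can be dropped. -/
theorem transportGraph_dissipative (ha : 0 < a) {P₁ : L1 Ineg →L[ℝ] L1 Ipos}
    {P₂ : L1 Ipos →L[ℝ] L1 Ineg} (hP₁ : ∀ f, ‖P₁ f‖ ≤ ‖f‖) (hP₂ : ∀ f, ‖P₂ f‖ ≤ ‖f‖)
    {q : L1Phase a × L1Phase a} (hq : q ∈ transportGraph a P₁ P₂) {l : ℝ} (hl : 0 < l) :
    l * ‖q.1‖ ≤ ‖l • q.1 - q.2‖ := by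
  obtain ⟨n, p, h⟩ := (mem_transportGraph_iff ha).1 hq
  have key := h.integral_le ha hl (L1.integrable_coeFn _) (L1.integrable_coeFn _)
    (integrable_glue _ _) (integrable_glue _ _)
  rw [integral_abs_glue, integral_abs_glue] at key
  have e : ∫ x, |l * q.1 x + (-q.2 : L1Phase a) x| ∂(phaseMeasure a) = ‖l • q.1 - q.2‖ := by
    rw [L1.norm_eq_integral_norm]
    refine integral_congr_ae ?_
    filter_upwards [Lp.coeFn_sub (l • q.1) q.2, Lp.coeFn_smul l q.1, Lp.coeFn_neg q.2]
      with x h1 h2 h3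
    rw [h1, h3, Pi.sub_apply, h2, Pi.smul_apply, Pi.neg_apply, smul_eq_mul, Real.norm_eq_abs,
      sub_eq_add_neg]
  rw [e, show ∫ x, |q.1 x| ∂(phaseMeasure a) = ‖q.1‖ from (L1.norm_eq_integral_norm q.1).symm]
    at key
  have := hP₁ n
  have := hP₂ p
  linarith

end StreamsAlgebra

/-! ### Solving the resolvent equation. -/

/-- Multiplication by a bounded function on `L¹(I)`. -/
theorem exists_mul_clm {I : Set ℝ} {e : ℝ → ℝ} (he : Measurable e) {c : ℝ}
    (hb : ∀ᵐ v ∂((volume : Measure ℝ).restrict I), |e v| ≤ c) :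
    ∃ E : L1 I →L[ℝ] L1 I, (∀ f, ‖E f‖ ≤ c * ‖f‖) ∧
      ∀ f, E f =ᵐ[(volume : Measure ℝ).restrict I] fun v => e v * f v := by
  have hi : ∀ f : L1 I, Integrable (fun v => e v * f v) ((volume : Measure ℝ).restrict I) :=
    fun f => (L1.integrable_coeFn f).bdd_mul (c := c) he.aestronglyMeasurable hb
  set E₀ : L1 I →ₗ[ℝ] L1 I :=
    { toFun := fun f => (hi f).toL1 _
      map_add' := fun f g => by
        rw [← Integrable.toL1_add, Integrable.toL1_eq_toL1_iff]
        filter_upwards [Lp.coeFn_add f g] with v hv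
        rw [hv, Pi.add_apply, Pi.add_apply, mul_add]
      map_smul' := fun r f => by
        rw [RingHom.id_apply, ← Integrable.toL1_smul, Integrable.toL1_eq_toL1_iff]
        filter_upwards [Lp.coeFn_smul r f] with v hv
        rw [hv, Pi.smul_apply, smul_eq_mul, smul_eq_mul, mul_left_comm] } with hE₀
  have hE : ∀ f, E₀ f =ᵐ[(volume : Measure ℝ).restrict I] fun v => e v * f v := fun f =>
    Integrable.coeFn_toL1 (hi f)
  have hbd : ∀ f, ‖E₀ f‖ ≤ c * ‖f‖ := by
    intro f
    rw [L1.norm_eq_integral_norm, L1.norm_eq_integral_norm, ← integral_const_mul]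
    refine integral_mono_ae (L1.integrable_coeFn _).norm
      ((L1.integrable_coeFn f).norm.const_mul c) ?_
    filter_upwards [hE f, hb] with v h1 h2
    rw [h1, norm_mul]
    exact mul_le_mul_of_nonneg_right h2 (norm_nonneg _)
  exact ⟨E₀.mkContinuous c hbd, hbd, hE⟩

theorem exists_fixedPoint_of_norm_lt_one {E : Type*} [NormedAddCommGroup E] [NormedSpace ℝ E]
    [CompleteSpace E] {T : E →L[ℝ] E} {c : ℝ} (hc0 : 0 ≤ c) (hc : c < 1)
    (hT : ∀ x, ‖T x‖ ≤ c * ‖x‖) (b : E) : ∃ x, x = T x + b := by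
  have hct : ContractingWith ⟨c, hc0⟩ (fun x => T x + b) := by
    refine ⟨by exact_mod_cast hc, LipschitzWith.of_dist_le_mul fun x y => ?_⟩
    rw [dist_eq_norm, dist_eq_norm, add_sub_add_right_eq_sub, ← map_sub]
    exact hT _
  exact ⟨hct.fixedPoint, hct.fixedPoint_isFixedPt.symm⟩

section Resolvent

variable {a l : ℝ}

/-- The flux at depth `x` along the characteristic of velocity `v`, for the source `h` and the
incoming flux `j`. -/
noncomputable def travelFlux (a l : ℝ) (j : ℝ → ℝ) (h : ℝ × ℝ → ℝ) (x v : ℝ) : ℝ :=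
  travel (l / |v|) (-a) (j v) (fun y => h (dir v * y, v)) x

/-- The solution `f` of `l f + v ∂f/∂x = h` with incoming flux `j`. -/
noncomputable def resolventSolution (a l : ℝ) (j : ℝ → ℝ) (h : ℝ × ℝ → ℝ) (p : ℝ × ℝ) : ℝ :=
  |p.2|⁻¹ * travelFlux a l j h (dir p.2 * p.1) p.2

theorem measurable_travelFlux {j : ℝ → ℝ} {h : ℝ × ℝ → ℝ} (hj : Measurable j)
    (hh : Measurable h) : Measurable fun p : ℝ × ℝ => travelFlux a l j h p.1 p.2 := by
  have hd : Measurable fun p : ℝ × ℝ => dir p.2 := measurable_dir.comp measurable_snd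
  have hκ : Measurable fun p : ℝ × ℝ => l / |p.2| :=
    measurable_const.div (measurable_abs.comp measurable_snd)
  have h1 : Measurable fun p : ℝ × ℝ =>
      Real.exp (l / |p.2| * (p.1 - (-a))) * h (dir p.2 * p.1, p.2) :=
    (hκ.mul (measurable_fst.sub_const _)).exp.mul
      (hh.comp ((hd.mul measurable_fst).prodMk measurable_snd))
  exact (hκ.mul (measurable_fst.sub_const _)).neg.exp.mul
    ((hj.comp measurable_snd).add (measurable_primitive h1 (-a)))

theorem measurable_resolventSolution {j : ℝ → ℝ} {h : ℝ × ℝ → ℝ} (hj : Measurable j)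
    (hh : Measurable h) : Measurable (resolventSolution a l j h) := by
  have hd : Measurable fun p : ℝ × ℝ => dir p.2 := measurable_dir.comp measurable_snd
  exact (measurable_abs.comp measurable_snd).inv.mul
    ((measurable_travelFlux hj hh).comp ((hd.mul measurable_fst).prodMk measurable_snd))

theorem dir_mul_dir_mul (v x : ℝ) : dir v * (dir v * x) = x := by
  unfold dir; split_ifs <;> simp

theorem abs_mul_resolventSolution (j : ℝ → ℝ) (h : ℝ × ℝ → ℝ) {v : ℝ} (hv : v ≠ 0) (x : ℝ) :
    |v| * resolventSolution a l j h (dir v * x, v) = travelFlux a l j h x v := by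
  simp only [resolventSolution]
  rw [mul_inv_cancel_left₀ (abs_ne_zero.2 hv), dir_mul_dir_mul]

theorem streamsOnPhase_resolventSolution (ha : 0 < a) (j : ℝ → ℝ) {h : ℝ × ℝ → ℝ}
    (hh : Integrable h (phaseMeasure a)) :
    StreamsOnPhase a (resolventSolution a l j h) (fun p => h p - l * resolventSolution a l j h p) j
      (travelFlux a l j h a) := by
  filter_upwards [ae_integrable_section_dir hh, ae_velocity_ne_zero] with v h1 hv
  have key := streams_travel ha (l / |v|) (j v) h1
  simp only [abs_mul_resolventSolution j h hv]
  refine key.congr ha EventuallyEq.rfl (Eventually.of_forall fun y => ?_)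
  have := abs_mul_resolventSolution (a := a) (l := l) j h hv y
  change _ - l / |v| * travelFlux a l j h y v = _
  rw [← this, ← mul_assoc, div_mul_cancel₀ _ (abs_ne_zero.2 hv)]

/-- The factor `|v|⁻¹` in the solution is compensated by the absorption rate `l / |v|`: the estimate
on each slice has no weight, and Tonelli integrates it over `v`. -/
theorem integrable_resolventSolution (ha : 0 < a) (hl : 0 < l) {j : ℝ → ℝ} {h : ℝ × ℝ → ℝ}
    (hjm : Measurable j) (hj : Integrable j ((volume : Measure ℝ).restrict (Ioo (-1) 1)))
    (hhm : Measurable h) (hh : Integrable h (phaseMeasure a)) :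
    Integrable (resolventSolution a l j h) (phaseMeasure a) ∧
      Integrable (travelFlux a l j h a) ((volume : Measure ℝ).restrict (Ioo (-1) 1)) := by
  have hm := measurable_resolventSolution (a := a) (l := l) hjm hhm
  have hmk : Measurable (travelFlux a l j h a) :=
    (measurable_travelFlux (a := a) (l := l) hjm hhm).comp measurable_prodMk_left
  have hsec : ∀ᵐ v ∂((volume : Measure ℝ).restrict (Ioo (-1) 1)),
      Integrable (fun x => resolventSolution a l j h (x, v))
        ((volume : Measure ℝ).restrict (Ioo (-a) a)) := by
    filter_upwards [ae_integrable_section_dir hh] with v h1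
    have h2 := (continuousOn_travel (l / |v|) (j v)
      ((intervalIntegrable_iff_restrict_Ioo ha).2 h1)).intervalIntegrable (μ := volume)
    exact (measurePreserving_dir_mul a v).integrable_comp_of_integrable
      (((intervalIntegrable_iff_restrict_Ioo ha).1 h2).const_mul |v|⁻¹)
  have hest : ∀ᵐ v ∂((volume : Measure ℝ).restrict (Ioo (-1) 1)),
      l * (∫ x, |resolventSolution a l j h (x, v)|
        ∂((volume : Measure ℝ).restrict (Ioo (-a) a))) + |travelFlux a l j h a v| ≤
      |j v| + ∫ x, |h (x, v)| ∂((volume : Measure ℝ).restrict (Ioo (-a) a)) := by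
    filter_upwards [ae_integrable_section_dir hh, ae_velocity_ne_zero] with v h1 hv
    have h2 := integral_abs_travel_le (κ := l / |v|) (j v) (by positivity)
      (show -a ≤ a by linarith) ((intervalIntegrable_iff_restrict_Ioo ha).2 h1)
    rw [intervalIntegral_eq_restrict_Ioo ha, intervalIntegral_eq_restrict_Ioo ha,
      integral_section_dir (fun p => |h p|) v] at h2
    refine le_trans (add_le_add_left (le_of_eq ?_) _) h2
    rw [← integral_section_dir (fun p => |resolventSolution a l j h p|) v,
      div_mul_eq_mul_div, mul_div_assoc, ← integral_div]
    congr 2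
    ext x
    have := abs_mul_resolventSolution (a := a) (l := l) j h hv x
    rw [eq_div_iff (abs_ne_zero.2 hv), mul_comm, ← abs_abs v, ← abs_mul, abs_abs, this]
    rfl
  have hbd := hj.abs.add hh.abs.integral_prod_right
  constructor
  · refine (integrable_prod_iff' hm.aestronglyMeasurable).2 ⟨hsec, ?_⟩
    refine (hbd.const_mul l⁻¹).mono' ?_ ?_
    · exact (hm.norm.comp measurable_swap).stronglyMeasurable.integral_prod_right'
        |>.aestronglyMeasurable
    · filter_upwards [hest] with v hv
      rw [Real.norm_of_nonneg (by positivity), inv_mul_eq_div, le_div_iff₀ hl, mul_comm]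
      exact (le_add_of_nonneg_right (abs_nonneg _)).trans hv
  · refine hbd.mono' hmk.aestronglyMeasurable ?_
    filter_upwards [hest] with v hv
    refine le_trans ?_ hv
    exact le_add_of_nonneg_left (by positivity)

theorem travelFlux_exit (j : ℝ → ℝ) (h : ℝ × ℝ → ℝ) (v : ℝ) :
    travelFlux a l j h a v =
      Real.exp (-(l / |v| * (2 * a))) * j v + travelFlux a l (fun _ => 0) h a v := by
  simp only [travelFlux, travel]
  rw [show a - -a = 2 * a by ring]
  ring

/-- Bounded speed gives a crossing time of at least `2a`, hence a damping factor below `1` that is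
uniform in `v`. -/
theorem abs_exp_le (ha : 0 < a) (hl : 0 < l) {v : ℝ} (hv : v ≠ 0) (hv1 : |v| ≤ 1) :
    |Real.exp (-(l / |v| * (2 * a)))| ≤ Real.exp (-(l * (2 * a))) := by
  rw [Real.abs_exp, Real.exp_le_exp, neg_le_neg_iff]
  refine mul_le_mul_of_nonneg_right ?_ (by linarith)
  rw [le_div_iff₀ (abs_pos.2 hv)]
  exact mul_le_of_le_one_right hl.le hv1

theorem measurable_exp_exit (a l : ℝ) :
    Measurable fun v : ℝ => Real.exp (-(l / |v| * (2 * a))) :=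
  (((measurable_const.div measurable_abs).mul_const _).neg).exp

/-- The outgoing fluxes must satisfy `p = E (P₁ n) + Mp` and `n = E' (P₂ p) + Mn`, where `E`, `E'`
are the damping over one crossing and `Mp`, `Mn` the contribution of the source. Eliminating `p`
leaves a fixed point equation for `n` whose linear part is a strict contraction. -/
theorem transportGraph_range (ha : 0 < a) (hl : 0 < l) {P₁ : L1 Ineg →L[ℝ] L1 Ipos}
    {P₂ : L1 Ipos →L[ℝ] L1 Ineg} (hP₁ : ∀ f, ‖P₁ f‖ ≤ ‖f‖) (hP₂ : ∀ f, ‖P₂ f‖ ≤ ‖f‖)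
    (h : L1Phase a) : ∃ q ∈ transportGraph a P₁ P₂, l • q.1 - q.2 = h := by
  have hhm : Measurable h := (Lp.stronglyMeasurable h).measurable
  have hh := L1.integrable_coeFn h
  set c := Real.exp (-(l * (2 * a))) with hc
  have hc0 : 0 ≤ c := (Real.exp_pos _).le
  have hc1 : c < 1 := by
    rw [hc, Real.exp_lt_one_iff]
    have : 0 < l * (2 * a) := by positivity
    linarith
  obtain ⟨E, hE, hE'⟩ := exists_mul_clm (I := Ipos) (measurable_exp_exit a l) (c := c) (by
    filter_upwards [ae_restrict_mem measurableSet_Ioo] with v hv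
    exact abs_exp_le ha hl hv.1.ne' (abs_le.2 ⟨by linarith [hv.1], hv.2.le⟩))
  obtain ⟨E', hE₁, hE₁'⟩ := exists_mul_clm (I := Ineg) (measurable_exp_exit a l) (c := c) (by
    filter_upwards [ae_restrict_mem measurableSet_Ioo] with v hv
    exact abs_exp_le ha hl hv.2.ne (abs_le.2 ⟨hv.1.le, by linarith [hv.2]⟩))
  have hM : Integrable (travelFlux a l (fun _ => 0) h a)
      ((volume : Measure ℝ).restrict (Ioo (-1) 1)) :=
    (integrable_resolventSolution ha hl measurable_const (integrable_zero ℝ ℝ _) hhm hh).2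
  rw [velocityMeasure_eq, integrable_add_measure] at hM
  set Mp : L1 Ipos := hM.1.toL1 _ with hMp
  set Mn : L1 Ineg := hM.2.toL1 _ with hMn
  obtain ⟨n, hn⟩ := exists_fixedPoint_of_norm_lt_one
    (T := (E'.comp P₂).comp (E.comp P₁)) hc0 hc1 (fun x => by
      calc ‖E' (P₂ (E (P₁ x)))‖ ≤ c * (c * ‖x‖) := by
            refine (hE₁ _).trans (mul_le_mul_of_nonneg_left ?_ hc0)
            refine (hP₂ _).trans ((hE _).trans (mul_le_mul_of_nonneg_left (hP₁ _) hc0))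
        _ ≤ 1 * (c * ‖x‖) := by gcongr
        _ = c * ‖x‖ := one_mul _) (E' (P₂ Mp) + Mn)
  set p : L1 Ipos := E (P₁ n) + Mp with hp
  have hn' : n = E' (P₂ p) + Mn := by
    rw [hp, map_add, map_add, add_assoc]
    exact hn
  set j := glue (P₁ n) (P₂ p) with hj
  have hexit : travelFlux a l j h a =ᵐ[(volume : Measure ℝ).restrict (Ioo (-1) 1)] glue p n := by
    refine ae_velocity_iff.2 ⟨?_, ?_⟩
    · filter_upwards [glue_ae_eq_pos p n, glue_ae_eq_pos (P₁ n) (P₂ p), hE' (P₁ n),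
        Lp.coeFn_add (E (P₁ n)) Mp, Integrable.coeFn_toL1 hM.1] with v h1 h2 h3 h4 h5
      rw [h1, travelFlux_exit, hj, h2, hp, h4, Pi.add_apply, h3, h5]
    · filter_upwards [glue_ae_eq_neg p n, glue_ae_eq_neg (P₁ n) (P₂ p), hE₁' (P₂ p),
        Lp.coeFn_add (E' (P₂ p)) Mn, Integrable.coeFn_toL1 hM.2] with v h1 h2 h3 h4 h5
      rw [h1, travelFlux_exit, hj, h2]
      conv_rhs => rw [hn']
      rw [h4, Pi.add_apply, h3, h5]
  have hfi := (integrable_resolventSolution ha hl (measurable_glue _ _)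
    (integrable_glue (P₁ n) (P₂ p)) hhm hh).1
  set f : L1Phase a := hfi.toL1 _ with hf
  have hfe : f =ᵐ[phaseMeasure a] resolventSolution a l j h := Integrable.coeFn_toL1 hfi
  refine ⟨(f, l • f - h), (mem_transportGraph_iff ha).2 ⟨n, p, ?_⟩, by simp⟩
  refine (streamsOnPhase_resolventSolution (l := l) ha j hh).congr ha hfe.symm ?_
    EventuallyEq.rfl hexit
  rw [neg_sub]
  filter_upwards [hfe, Lp.coeFn_sub h (l • f), Lp.coeFn_smul l f] with x h1 h2 h3
  rw [h2, Pi.sub_apply, h3, Pi.smul_apply, h1, smul_eq_mul]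

end Resolvent

/-! ### Density of the domain. -/

section Density

variable {a : ℝ}

theorem dir_mul_self (v : ℝ) : |v| * dir v = v := by
  unfold dir
  split_ifs with h
  · rw [mul_one, abs_of_pos h]
  · rw [mul_neg_one, abs_of_nonpos (not_lt.1 h), neg_neg]

/-- A smooth function vanishing at `x = ±a` streams without boundary fluxes. -/
theorem streamsOnPhase_of_contDiff {F : ℝ × ℝ → ℝ} (hF : ContDiff ℝ 1 F)
    (hz : ∀ v, F (a, v) = 0 ∧ F (-a, v) = 0) :
    StreamsOnPhase a F (fun p => p.2 * fderiv ℝ F p (1, 0)) (fun _ => 0) (fun _ => 0) := by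
  refine Eventually.of_forall fun v => ?_
  have hder : ∀ y, HasDerivAt (fun y : ℝ => |v| * F (dir v * y, v))
      (v * fderiv ℝ F (dir v * y, v) (1, 0)) y := by
    intro y
    have h1 := (hF.differentiable one_ne_zero (dir v * y, v)).hasFDerivAt
    have h2 : HasDerivAt (fun y : ℝ => (dir v * y, v)) (dir v * 1, 0) y :=
      ((hasDerivAt_id' y).const_mul (dir v)).prodMk (hasDerivAt_const y v)
    have h3 := (h1.comp_hasDerivAt y h2).const_mul |v|
    rw [show ((dir v * 1, 0) : ℝ × ℝ) = dir v • ((1, 0) : ℝ × ℝ) by simp, map_smul, smul_eq_mul,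
      ← mul_assoc, dir_mul_self] at h3
    exact h3
  have hc : Continuous fun y => v * fderiv ℝ F (dir v * y, v) (1, 0) := by
    have := (hF.continuous_fderiv one_ne_zero).clm_apply
      (continuous_const (y := ((1, 0) : ℝ × ℝ)))
    exact continuous_const.mul (this.comp (by fun_prop))
  have hend : ∀ s : ℝ, s = a ∨ s = -a → F (dir v * s, v) = 0 := by
    intro s hs
    unfold dir
    rcases hs with rfl | rfl <;> split_ifs <;> simp [hz v]
  have hint : ∀ x, ∫ y in (-a)..x, v * fderiv ℝ F (dir v * y, v) (1, 0) =
      |v| * F (dir v * x, v) := by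
    intro x
    rw [intervalIntegral.integral_eq_sub_of_hasDerivAt (fun y _ => hder y)
      (hc.intervalIntegrable _ _), hend (-a) (Or.inr rfl)]
    ring
  refine ⟨Eventually.of_forall fun x => ?_, ?_⟩
  · simp only [hint, zero_add]
  · simp only [hint, zero_add, hend a (Or.inl rfl), mul_zero]

/-- Zero fluxes satisfy every linear boundary condition, so it suffices to approximate by functions
vanishing at `x = ±a`. The cutoffs `1 - (x/a)^(2n+2)` vanish there and increase to `1` inside;
dominated convergence gives the `L¹` limit. -/
theorem transportGraph_dense (ha : 0 < a) (P₁ : L1 Ineg →L[ℝ] L1 Ipos)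
    (P₂ : L1 Ipos →L[ℝ] L1 Ineg) :
    Dense (Prod.fst '' (transportGraph a P₁ P₂)) := by
  have hS := Lp.dense_hasCompactSupport_contDiff (F := ℝ) (μ := phaseMeasure a)
    ENNReal.one_ne_top
  refine dense_closure.1 (hS.mono ?_)
  rintro f ⟨g, hfg, hgc, hg⟩
  set F : ℕ → ℝ × ℝ → ℝ := fun n p => (1 - (p.1 / a) ^ (2 * n + 2)) * g p with hF
  have hFs : ∀ n, ContDiff ℝ 1 (F n) := fun n =>
    ContDiff.mul (by fun_prop) (hg.of_le (by exact_mod_cast le_top))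
  have hFc : ∀ n, HasCompactSupport (F n) := fun n => hgc.mul_left
  have hFi : ∀ n, Integrable (F n) (phaseMeasure a) := fun n =>
    (hFs n).continuous.integrable_of_hasCompactSupport (hFc n)
  have hWi : ∀ n, Integrable (fun p => p.2 * fderiv ℝ (F n) p (1, 0)) (phaseMeasure a) := by
    intro n
    refine Continuous.integrable_of_hasCompactSupport ?_ ?_
    · exact continuous_snd.mul
        (((hFs n).continuous_fderiv one_ne_zero).clm_apply continuous_const)
    · refine HasCompactSupport.mul_left ?_
      exact ((hFc n).fderiv (𝕜 := ℝ)).comp_left (g := fun L : (ℝ × ℝ) →L[ℝ] ℝ => L (1, 0)) rfl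
  have hmem : ∀ n, (hFi n).toL1 _ ∈ Prod.fst '' (transportGraph a P₁ P₂) := by
    intro n
    refine ⟨((hFi n).toL1 _, -(hWi n).toL1 _), (mem_transportGraph_iff ha).2 ⟨0, 0, ?_⟩, rfl⟩
    refine (streamsOnPhase_of_contDiff (hFs n) fun v => ?_).congr ha
      (Integrable.coeFn_toL1 (hFi n)).symm ?_ ?_ glue_zero.symm
    · have hev : Even (2 * n + 2) := ⟨n + 1, by ring⟩
      simp [hF, ha.ne', hev.neg_pow]
    · rw [neg_neg]
      exact (Integrable.coeFn_toL1 (hWi n)).symm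
    · rw [map_zero, map_zero]
      exact glue_zero.symm
  refine mem_closure_of_tendsto (f := fun n => (hFi n).toL1 _) (b := atTop) ?_
    (Eventually.of_forall hmem)
  rw [tendsto_iff_norm_sub_tendsto_zero]
  have hgi : Integrable g (phaseMeasure a) :=
    hg.continuous.integrable_of_hasCompactSupport hgc
  have hnorm : ∀ n, ‖(hFi n).toL1 _ - f‖ = ∫ p, |F n p - g p| ∂(phaseMeasure a) := by
    intro n
    rw [L1.norm_eq_integral_norm]
    refine integral_congr_ae ?_
    filter_upwards [Lp.coeFn_sub ((hFi n).toL1 _) f, Integrable.coeFn_toL1 (hFi n), hfg]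
      with p h1 h2 h3
    rw [h1, Pi.sub_apply, h2, h3, Real.norm_eq_abs]
  simp only [hnorm]
  have hbase : ∀ᵐ p ∂(phaseMeasure a), |p.1 / a| < 1 := by
    have h0 : ∀ᵐ x ∂((volume : Measure ℝ).restrict (Ioo (-a) a)), |x / a| < 1 := by
      filter_upwards [ae_restrict_mem measurableSet_Ioo] with x hx
      rw [abs_div, abs_of_pos ha, div_lt_one ha]
      exact abs_lt.2 hx
    exact Measure.quasiMeasurePreserving_fst.ae h0
  have hsub : ∀ n p, |F n p - g p| = |p.1 / a| ^ (2 * n + 2) * |g p| := by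
    intro n p
    rw [show F n p - g p = -((p.1 / a) ^ (2 * n + 2) * g p) by simp only [hF]; ring, abs_neg,
      abs_mul, abs_pow]
  rw [show (0 : ℝ) = ∫ _, (0 : ℝ) ∂(phaseMeasure a) by simp]
  refine tendsto_integral_of_dominated_convergence (fun p => |g p|) (fun n => ?_) hgi.abs
    (fun n => ?_) ?_
  · exact ((hFi n).sub hgi).abs.aestronglyMeasurable
  · filter_upwards [hbase] with p hp
    rw [hsub, Real.norm_of_nonneg (by positivity)]
    exact mul_le_of_le_one_left (abs_nonneg _) (pow_le_one₀ (abs_nonneg _) hp.le)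
  · filter_upwards [hbase] with p hp
    simp only [hsub]
    have h1 : Tendsto (fun n : ℕ => 2 * n + 2) atTop atTop :=
      tendsto_atTop_mono (fun n => by simp only [id]; omega) tendsto_id
    have h2 := ((tendsto_pow_atTop_nhds_zero_of_lt_one (abs_nonneg _) hp).comp h1).mul_const |g p|
    simpa using h2

end Density

/-! ### The stationary density built from an eigenpair. -/

section InvariantDensity

variable {a : ℝ}

theorem exists_stationary_density (ha : 0 < a) {P₁ : L1 Ineg →L[ℝ] L1 Ipos}
    {P₂ : L1 Ipos →L[ℝ] L1 Ineg} {h : L1 Ipos} {h' : L1 Ineg} (hh : IsEigenPair P₁ P₂ h h')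
    (hi : InvWeightIntegrable h) (hi' : InvWeightIntegrable h') :
    ∃ ψ : L1Phase a, 0 ≤ ψ ∧ ∫ p, ψ p ∂(phaseMeasure a) = 1 ∧
      (ψ, (0 : L1Phase a)) ∈ transportGraph a P₁ P₂ := by
  obtain ⟨g, hg⟩ := hi
  obtain ⟨g', hg'⟩ := hi'
  have hgl : ∀ᵐ v ∂((volume : Measure ℝ).restrict (Ioo (-1) 1)),
      |v| * glue g g' v = glue h h' v := by
    refine ae_velocity_iff.2 ⟨?_, ?_⟩
    · filter_upwards [hg, glue_ae_eq_pos g g', glue_ae_eq_pos h h', ae_ne_zero_Ipos]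
        with v h1 h2 h3 h4
      rw [h2, h3, h1, mul_inv_cancel_left₀ (abs_ne_zero.2 h4)]
    · filter_upwards [hg', glue_ae_eq_neg g g', glue_ae_eq_neg h h', ae_ne_zero_Ineg]
        with v h1 h2 h3 h4
      rw [h2, h3, h1, mul_inv_cancel_left₀ (abs_ne_zero.2 h4)]
  have hfi : Integrable (fun p : ℝ × ℝ => glue g g' p.2) (phaseMeasure a) :=
    (integrable_glue g g').comp_snd _
  set f : L1Phase a := hfi.toL1 _ with hf
  have hfe : f =ᵐ[phaseMeasure a] fun p => glue g g' p.2 := Integrable.coeFn_toL1 hfi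
  have hnn : ∀ᵐ v ∂((volume : Measure ℝ).restrict (Ioo (-1) 1)), 0 ≤ glue g g' v := by
    refine ae_velocity_iff.2 ⟨?_, ?_⟩
    · filter_upwards [hg, glue_ae_eq_pos g g', (Lp.coeFn_nonneg h).2 hh.nonneg] with v h1 h2 h3
      rw [h2, h1]
      exact mul_nonneg (inv_nonneg.2 (abs_nonneg v)) h3
    · filter_upwards [hg', glue_ae_eq_neg g g', (Lp.coeFn_nonneg h').2 hh.nonneg'] with v h1 h2 h3
      rw [h2, h1]
      exact mul_nonneg (inv_nonneg.2 (abs_nonneg v)) h3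
  have hf0 : 0 ≤ f := by
    rw [← Lp.coeFn_nonneg]
    filter_upwards [hfe, ae_phaseMeasure_of_ae_velocity hnn] with p h1 h2
    rw [h1]
    exact h2
  have hgraph : (f, (0 : L1Phase a)) ∈ transportGraph a P₁ P₂ := by
    -- The flux is constant along each characteristic, so incoming and outgoing fluxes coincide; the
    -- eigenpair equations are precisely this matching.
    refine (mem_transportGraph_iff ha).2 ⟨h', h, ?_⟩
    rw [hh.map_h, hh.map_h', neg_zero]
    have h0 : StreamsOnPhase a (fun p => glue g g' p.2) (fun _ => 0) (glue h h') (glue h h') := by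
      filter_upwards [hgl] with v hv
      refine ⟨Eventually.of_forall fun x => ?_, ?_⟩
      · simp [hv]
      · simp
    exact h0.congr ha hfe.symm (Lp.coeFn_zero _ _ _).symm EventuallyEq.rfl EventuallyEq.rfl
  have hne : f ≠ 0 := by
    intro h0
    rw [h0] at hfe
    have h1 : ∀ᵐ p ∂(phaseMeasure a), glue g g' p.2 = 0 := by
      filter_upwards [hfe, Lp.coeFn_zero ℝ 1 (phaseMeasure a)] with p h1 h2
      rw [← h1, h2, Pi.zero_apply]
    have hne : NeBot (ae ((volume : Measure ℝ).restrict (Ioo (-a) a))) := by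
      rw [ae_neBot, ne_eq, Measure.restrict_eq_zero, Real.volume_Ioo]
      simp [ha]
    have h2 : ∀ᵐ v ∂((volume : Measure ℝ).restrict (Ioo (-1) 1)), glue h h' v = 0 := by
      filter_upwards [ae_ae_of_ae_phaseMeasure h1, hgl] with v h3 h4
      obtain ⟨x, hx⟩ := h3.exists
      rw [← h4, hx, mul_zero]
    refine hh.ne_zero ((Lp.eq_zero_iff_ae_eq_zero).2 ?_)
    filter_upwards [(ae_velocity_iff.1 h2).1, glue_ae_eq_pos h h'] with v h3 h4
    rw [← h4, h3, Pi.zero_apply]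
  have hn : 0 < ‖f‖ := norm_pos_iff.2 hne
  have hs0 : 0 ≤ ‖f‖⁻¹ • f := smul_nonneg_of_nonneg (inv_nonneg.2 hn.le) hf0
  refine ⟨‖f‖⁻¹ • f, hs0, ?_, ?_⟩
  · rw [← norm_eq_integral_of_nonneg hs0, norm_smul, norm_inv, norm_norm,
      inv_mul_cancel₀ hn.ne']
  · have := (transportSubmodule ha P₁ P₂).smul_mem ‖f‖⁻¹ hgraph
    rwa [Prod.smul_mk, smul_zero] at this

end InvariantDensity

end SlabTransport

/-! ### The main theorem. -/

theorem mainTheorem10 (a : ℝ) (ha : 0 < a) (α₁ β₁ α₂ β₂ : ℝ)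
    (hα₁ : 0 ≤ α₁) (hβ₁ : 0 ≤ β₁) (hsum₁ : α₁ + β₁ = 1)
    (hα₂ : 0 ≤ α₂) (hβ₂ : 0 ≤ β₂) (hsum₂ : α₂ + β₂ = 1)
    (K₁ : L1 Ineg →L[ℝ] L1 Ipos) (K₂ : L1 Ipos →L[ℝ] L1 Ineg)
    (hK₁ : IsStochastic K₁) (hK₁w : IsWeaklyCompact K₁)
    (hK₂ : IsStochastic K₂) (hK₂w : IsWeaklyCompact K₂)
    (hyp : (O₁ α₁ β₁ K₁ = K₁ ∧ InvWeightBounded K₁ ∧ ConjWeightBounded K₂) ∨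
      (O₂ α₂ β₂ K₂ = K₂ ∧ InvWeightBounded K₂ ∧ ConjWeightBounded K₁)) :
    (∃ (h₀ : L1 Ipos) (h₀' : L1 Ineg), IsEigenPair (O₁ α₁ β₁ K₁) (O₂ α₂ β₂ K₂) h₀ h₀') ∧
    (∀ (h₀ : L1 Ipos) (h₀' : L1 Ineg), IsEigenPair (O₁ α₁ β₁ K₁) (O₂ α₂ β₂ K₂) h₀ h₀' →
      IntegrabilityCondition h₀ h₀') ∧
    (∃ S : C0Semigroup (L1Phase a),
      S.generatorGraph = transportGraph a (O₁ α₁ β₁ K₁) (O₂ α₂ β₂ K₂)) ∧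
    (∀ S : C0Semigroup (L1Phase a),
      S.generatorGraph = transportGraph a (O₁ α₁ β₁ K₁) (O₂ α₂ β₂ K₂) →
      ∃ ψ : L1Phase a, IsInvariantDensity S ψ) := by
  have hO₁ := isStochastic_O₁ hα₁ hβ₁ hsum₁ hK₁
  have hO₂ := isStochastic_O₂ hα₂ hβ₂ hsum₂ hK₂
  have hw : IsWeaklyCompact (O₁ α₁ β₁ K₁) ∨ IsWeaklyCompact (O₂ α₂ β₂ K₂) := by
    rcases hyp with ⟨h, -⟩ | ⟨h, -⟩
    · exact Or.inl (by rwa [h])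
    · exact Or.inr (by rwa [h])
  have hpair := exists_isEigenPair hO₁ hO₂ hw
  refine ⟨hpair, fun h h' hh => ?_, ?_, fun S hS => ?_⟩
  · have := hh.invWeightIntegrable hyp
    exact integrabilityCondition_of_invWeightIntegrable this.1 this.2
  · exact exists_generatorGraph_eq (transportSubmodule ha _ _) (transportGraph_dense ha _ _)
      (fun q hq l hl => transportGraph_dissipative ha hO₁.norm_apply_le hO₂.norm_apply_le hq hl)
      (fun l hl h => transportGraph_range ha hl hO₁.norm_apply_le hO₂.norm_apply_le h)
  · obtain ⟨h, h', hh⟩ := hpair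
    have hi := hh.invWeightIntegrable hyp
    obtain ⟨ψ, h0, h1, hψ⟩ := exists_stationary_density ha hh hi.1 hi.2
    exact ⟨ψ, h0, h1, S.op_eq_of_mem_generatorGraph (hS ▸ hψ)⟩
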